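/- Let $a\in[0,1)$, $\sigma>0$, and let $U_0=0$, $U_i=aU_{i-1}+Z_i$ $(i\ge 1)$ with $Z_1,Z_2,\dots$ i.i.d. $\mathcal N(0,\sigma^2)$ (the Gauss–Markov source). All logarithms are natural. Write $\mathbf U=(U_1,\dots,U_n)^\top$, let $\mathsf\Sigma_{\mathbf U}=\mathbb E[\mathbf U\mathbf U^\top]=\mathsf S\,\mathrm{diag}(\sigma_1^2,\dots,\sigma_n^2)\,\mathsf S^\top$ with $\mathsf S$ orthogonal, and let $\mathbf X=\mathsf S^\top\mathbf U$ be the decorrelation of $\mathbf U$. For a random vector $\mathbf W$ in $\mathbb R^n$ put $$\mathbb R_{\mathbf W}(n,d)=\frac1n\inf_{P_{\mathbf V|\mathbf W}:\ \frac1n\mathbb E\|\mathbf W-\mathbf V\|_2^2\le d} I(\mathbf W;\mathbf V),\qquad \lambda^\star=-\frac{\partial}{\partial d}\mathbb R_{\mathbf W}(n,d),$$ $$\jmath_{\mathbf W}(\mathbf w,d)=-\lambda^\star nd-\log\mathbb E\left[\exp\left(-\lambda^\star\|\mathbf w-\mathbf V^\star\|_2^2\right)\right],$$ where $P_{\mathbf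 V^\star|\mathbf W}$ is any minimizer in $\mathbb R_{\mathbf W}(n,d)$ (the $\mathsf d$-tilted information). Let $\mathbb V_U(d)=\limsup_{n\to\infty}\frac1n\mathrm{Var}[\jmath_{\mathbf U}(\mathbf U,d)]$ be the informational dispersion, let $$S(w)=\frac{\sigma^2}{1+a^2-2a\cos w},\qquad d_{\max}=\frac1{2\pi}\int_{-\pi}^{\pi}S(w)\,dw=\frac{\sigma^2}{1-a^2},$$ and let $d\in(0,d_{\max})$. Then: (1) For every $n\ge1$ a minimizer in $\mathbb R_{\mathbf U}(n,d)$ exists, and $d<\frac1n\mathrm{tr}\,\mathsf\Sigma_{\mathbf U}$ for all sufficiently large $n$. For every $n\ge 1$ with $d<\frac1n\mathrm{tr}\,\mathsf\Sigma_{\mathbf U}$, a minimizer in $\mathbb R_{\mathbf X}(n,d)$ exists as well, $\mathbb R_{\mathbf U}(n,\cdot)$ and $\mathbb R_{\mathbf X}(n,\cdot)$ are differentiable at $d$, there is exactly one $\theta_n>0$ with $d=\frac1n\sum_{i=1}^n\min(\theta_n,\sigma_i^2)$, and for all $\mathbf u\in\mathbb R^n$ and $\mathbf x=\mathsf S^\top\mathbf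 u$, whichever minimizers are used, $$\jmath_{\mathbf U}(\mathbf u,d)=\jmath_{\mathbf X}(\mathbf x,d)=\sum_{i=1}^n\left[\frac{\min(\theta_n,\sigma_i^2)}{2\theta_n}\left(\frac{x_i^2}{\sigma_i^2}-1\right)+\frac12\log\frac{\max(\theta_n,\sigma_i^2)}{\theta_n}\right].$$ (2) There is exactly one $\theta>0$ with $d=\frac1{2\pi}\int_{-\pi}^{\pi}\min[\theta,S(w)]\,dw$, and for every choice of the minimizers in $\mathbb R_{\mathbf U}(n,d)$, $n\ge1$, $$\mathbb V_U(d)=\frac1{4\pi}\int_{-\pi}^{\pi}\min\left[1,\left(\frac{S(w)}{\theta}\right)^2\right]dw .$$ -/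

import Mathlib

open MeasureTheory ProbabilityTheory Filter
open scoped ENNReal NNReal

/-- `U 0, U 1, …` is the Gauss-Markov source with gain `a` and innovation variance `σ ^ 2`:
`U 0 = 0` and `U (i + 1) = a * U i + Z i`, where the innovations `Z 0, Z 1, …` are i.i.d.
`N(0, σ ^ 2)` (`Z i` is the innovation that enters at time `i + 1`). -/
def IsGaussMarkov {Ω : Type*} [MeasurableSpace Ω] (P : Measure Ω) (a : ℝ) (σ : ℝ≥0)
    (U : ℕ → Ω → ℝ) : Prop :=
  ∃ Z : ℕ → Ω → ℝ,
    (∀ i, Measurable (Z i)) ∧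
    (∀ i, P.map (Z i) = gaussianReal 0 (σ ^ 2)) ∧
    iIndepFun Z P ∧
    (∀ ω, U 0 ω = 0) ∧
    ∀ i ω, U (i + 1) ω = a * U i ω + Z i ω

/-- The source vector `(U 1, …, U n)`. -/
def sourceVec {Ω : Type*} (U : ℕ → Ω → ℝ) (n : ℕ) (ω : Ω) : EuclideanSpace ℝ (Fin n) :=
  WithLp.toLp 2 fun i => U (i + 1) ω

/-- The matrix `E[U Uᵀ]` of the source vector `(U 1, …, U n)`. -/
noncomputable def covMatrix {Ω : Type*} [MeasurableSpace Ω] (P : Measure Ω) (U : ℕ → Ω → ℝ)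
    (n : ℕ) : Matrix (Fin n) (Fin n) ℝ :=
  Matrix.of fun i j => ∫ ω, U (i + 1) ω * U (j + 1) ω ∂P

/-- The change of coordinates `u ↦ Sᵀ u`. -/
noncomputable def decorrelate {n : ℕ} (S : Matrix (Fin n) (Fin n) ℝ)
    (u : EuclideanSpace ℝ (Fin n)) : EuclideanSpace ℝ (Fin n) :=
  WithLp.toLp 2 (S.transpose.mulVec (WithLp.ofLp u))

/-- The mean squared error distortion on `ℝⁿ`. -/
noncomputable def distortion {n : ℕ} (u v : EuclideanSpace ℝ (Fin n)) : ℝ :=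
  (1 / (n : ℝ)) * ‖u - v‖ ^ 2

/-- The mutual information `I(X; Y)` of a pair with `X ∼ μ` and `P_{Y|X} = κ`: the relative
entropy of the joint law with respect to the product of the marginals. -/
noncomputable def mutualInfo {α β : Type*} [MeasurableSpace α] [MeasurableSpace β]
    (μ : Measure α) (κ : Kernel α β) : ℝ≥0∞ :=
  InformationTheory.klDiv (μ.compProd κ) (μ.prod (μ.bind κ))

/-- The expected distortion `E[d(X, Y)]` of a pair with `X ∼ μ` and `P_{Y|X} = κ`. -/
noncomputable def expectedDistortion {n : ℕ} (μ : Measure (EuclideanSpace ℝ (Fin n)))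
    (κ : Kernel (EuclideanSpace ℝ (Fin n)) (EuclideanSpace ℝ (Fin n))) : ℝ≥0∞ :=
  ∫⁻ u, ∫⁻ v, ENNReal.ofReal (distortion u v) ∂(κ u) ∂μ

/-- The infimum of `I(X; Y)` over all conditional distributions `P_{Y|X}` with
`E[d(X, Y)] ≤ d`, where `X ∼ μ`. -/
noncomputable def infMutualInfo {n : ℕ} (μ : Measure (EuclideanSpace ℝ (Fin n))) (d : ℝ) : ℝ≥0∞ :=
  ⨅ (κ : Kernel (EuclideanSpace ℝ (Fin n)) (EuclideanSpace ℝ (Fin n)))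
    (_ : IsMarkovKernel κ) (_ : expectedDistortion μ κ ≤ ENNReal.ofReal d), mutualInfo μ κ

/-- The `n`-th order rate-distortion function (in nats, normalized by `n`). -/
noncomputable def rdf {n : ℕ} (μ : Measure (EuclideanSpace ℝ (Fin n))) (d : ℝ) : ℝ :=
  (1 / (n : ℝ)) * (infMutualInfo μ d).toReal

/-- The conditional distribution `κ` attains the infimum in the rate-distortion function of `μ`
at distortion `d`. -/
structure IsRDFAchieving {n : ℕ} (μ : Measure (EuclideanSpace ℝ (Fin n))) (d : ℝ)
    (κ : Kernel (EuclideanSpace ℝ (Fin n)) (EuclideanSpace ℝ (Fin n))) : Prop where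
  isMarkov : IsMarkovKernel κ
  expectedDistortion_le : expectedDistortion μ κ ≤ ENNReal.ofReal d
  mutualInfo_eq : mutualInfo μ κ = infMutualInfo μ d

/-- The negative slope `λ* = -R'(d)` of the `n`-th order rate-distortion function. -/
noncomputable def negSlope {n : ℕ} (μ : Measure (EuclideanSpace ℝ (Fin n))) (d : ℝ) : ℝ :=
  -deriv (rdf μ) d

/-- The `d`-tilted information in `u`,
`-λ* n d - log E[exp (-λ* n d(u, V*))]`, where `V*` has the output law of `κ`. It is used for `κ`
that attains the rate-distortion function of `μ` at `d`. -/
noncomputable def tiltedInfo {n : ℕ} (μ : Measure (EuclideanSpace ℝ (Fin n))) (d : ℝ)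
    (κ : Kernel (EuclideanSpace ℝ (Fin n)) (EuclideanSpace ℝ (Fin n)))
    (u : EuclideanSpace ℝ (Fin n)) : ℝ :=
  -negSlope μ d * n * d -
    Real.log (∫ v, Real.exp (-negSlope μ d * n * distortion u v) ∂(μ.bind κ))

/-- The informational dispersion `limsup (1/n) Var[j(U, d)]`, as an extended nonnegative real,
computed with the rate-distortion achieving conditional distributions `κ n`. -/
noncomputable def informationalDispersion {Ω : Type*} [MeasurableSpace Ω] (P : Measure Ω)
    (U : ℕ → Ω → ℝ) (d : ℝ)
    (κ : ∀ n : ℕ, Kernel (EuclideanSpace ℝ (Fin n)) (EuclideanSpace ℝ (Fin n))) : ℝ≥0∞ :=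
  limsup (fun n : ℕ =>
    evariance (fun ω => tiltedInfo (P.map (sourceVec U n)) d (κ n) (sourceVec U n ω)) P
      / (n : ℝ≥0∞)) atTop

/-- `θ` is the water level matched to `d` via reverse waterfilling over the variances `s`. -/
def IsWaterLevel {n : ℕ} (s : Fin n → ℝ) (d θ : ℝ) : Prop :=
  0 < θ ∧ d = (1 / (n : ℝ)) * ∑ i, min θ (s i)

/-- The power spectrum `S(w) = σ² / (1 + a² - 2 a cos w)`. -/
noncomputable def powerSpectrum (a : ℝ) (σ : ℝ≥0) (w : ℝ) : ℝ :=
  (σ : ℝ) ^ 2 / (1 + a ^ 2 - 2 * a * Real.cos w)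

/-- `θ` is the water level matched to `d` via the limiting reverse waterfilling. -/
def IsLimitingWaterLevel (a : ℝ) (σ : ℝ≥0) (d θ : ℝ) : Prop :=
  0 < θ ∧ d = (1 / (2 * Real.pi)) * ∫ w in (-Real.pi)..Real.pi, min θ (powerSpectrum a σ w)

/-- The maximum distortion `d_max = (1/2π) ∫ S(w) dw`. -/
noncomputable def maxDistortion (a : ℝ) (σ : ℝ≥0) : ℝ :=
  (1 / (2 * Real.pi)) * ∫ w in (-Real.pi)..Real.pi, powerSpectrum a σ w

/-! Rate-distortion theory by convex duality. Suppose `j`, a slope `l` and an output law `ν` satisfy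
the Kuhn-Tucker conditions (`IsTiltCertificate`). For any channel, let `π` be its joint law, `τ` the
product of the marginals of `π`, and `ρ` the measure `τ` reweighted by the tilt density. Then `I =
KL(π‖τ)` is at least `KL(π‖ρ) + ∫ j` minus a term linear in the excess distortion (`le_mutualInfo`),
and the channel obtained by disintegrating the tilted `μ × ν` attains `∫ j`. Three facts follow: the
value is `∫ j`; the slopes `l` are subgradients, so they give the derivative where they are
continuous; and every minimizer has zero residual `KL(π‖ρ)`, which forces its tilted information to
be `j`, whatever minimizer is used (`eq_of_isRDFAchieving`).

For a Gaussian vector in diagonalizing coordinates the tilt density is a product. Above the water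
level a coordinate uses the backward channel `X = V + N(0, θ)`; below it the output is `0`. This
yields the certificate `isTiltCertificate_gaussianVec`. Its `j` is a sum of independent scaled
squares plus a constant, so its variance is `(1/2) ∑ (min(θ, sᵢ)/θ)²`. An orthogonal change of
coordinates alters neither distortion nor this formula, hence `U` and `X` are treated at once.

For the limit, let `B` be the bidiagonal matrix that recovers the innovations, so that the precision
matrix is `BᵀB/σ²`. Up to boundary effects `BᵀB` is Toeplitz with symbol `1 + a² - 2a cos w`. Its
normalized power traces converge to integrals of powers of the symbol, and the Weierstrass theorem
extends this to continuous functions of the eigenvalues (`tendsto_average`). Clipped variances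
`min(t, sᵢ)` are such functions. Concavity of the waterfilling curves gives `θₙ → θ`
(`tendsto_level`), and the normalized variances converge, so the limsup is a limit
(`tendsto_dispersion`). -/

/-! ### Duality: Kuhn-Tucker certificates for the rate-distortion function. -/

section TiltedInformation

variable {n : ℕ}

/-- The logarithm `j(x) + l * d - l * d(x, v)` of the candidate joint density. -/
noncomputable def tiltExponent (j : EuclideanSpace ℝ (Fin n) → ℝ) (l d : ℝ)
    (p : EuclideanSpace ℝ (Fin n) × EuclideanSpace ℝ (Fin n)) : ℝ :=
  j p.1 + l * d - l * distortion p.1 p.2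

/-- The candidate joint density `exp (j(x) + l * d - l * d(x, v))`. -/
noncomputable def tiltDensity (j : EuclideanSpace ℝ (Fin n) → ℝ) (l d : ℝ)
    (p : EuclideanSpace ℝ (Fin n) × EuclideanSpace ℝ (Fin n)) : ℝ≥0∞ :=
  ENNReal.ofReal (Real.exp (tiltExponent j l d p))

/-- A certificate for the rate-distortion function of `μ` at `d`: a tilted information `j`, a
slope `l` and an output law `ν` satisfying the Kuhn-Tucker conditions. -/
structure IsTiltCertificate (μ : Measure (EuclideanSpace ℝ (Fin n))) (d l : ℝ)
    (j : EuclideanSpace ℝ (Fin n) → ℝ) (ν : Measure (EuclideanSpace ℝ (Fin n))) : Prop where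
  slope_nonneg : 0 ≤ l
  dist_nonneg : 0 ≤ d
  continuous : Continuous j
  integrable : Integrable j μ
  lintegral_fst_le : ∀ v, ∫⁻ x, tiltDensity j l d (x, v) ∂μ ≤ 1
  lintegral_fst_eq : ∀ᵐ v ∂ν, ∫⁻ x, tiltDensity j l d (x, v) ∂μ = 1
  lintegral_snd_eq : ∀ x, ∫⁻ v, tiltDensity j l d (x, v) ∂ν = 1
  lintegral_dist : ∫⁻ v, ∫⁻ x, tiltDensity j l d (x, v) * ENNReal.ofReal (distortion x v) ∂μ ∂ν
    = ENNReal.ofReal d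

lemma distortion_nonneg (u v : EuclideanSpace ℝ (Fin n)) : 0 ≤ distortion u v := by
  unfold distortion; positivity

@[fun_prop]
lemma continuous_distortion :
    Continuous fun p : EuclideanSpace ℝ (Fin n) × EuclideanSpace ℝ (Fin n) =>
      distortion p.1 p.2 := by
  unfold distortion; fun_prop

lemma expectedDistortion_eq_lintegral_compProd (μ : Measure (EuclideanSpace ℝ (Fin n)))
    [SFinite μ] (κ : Kernel (EuclideanSpace ℝ (Fin n)) (EuclideanSpace ℝ (Fin n)))
    [IsSFiniteKernel κ] :
    expectedDistortion μ κ = ∫⁻ p, ENNReal.ofReal (distortion p.1 p.2) ∂(μ.compProd κ) := by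
  rw [Measure.lintegral_compProd]
  · rfl
  · exact continuous_distortion.measurable.ennreal_ofReal

section

variable {j : EuclideanSpace ℝ (Fin n) → ℝ} {l d : ℝ}

lemma continuous_tiltExponent (hj : Continuous j) : Continuous (tiltExponent j l d) := by
  unfold tiltExponent; fun_prop

lemma tiltDensity_def :
    tiltDensity j l d = fun p => ENNReal.ofReal (Real.exp (tiltExponent j l d p)) := rfl

lemma measurable_tiltDensity (hj : Continuous j) : Measurable (tiltDensity j l d) :=
  (Real.continuous_exp.comp (continuous_tiltExponent hj)).measurable.ennreal_ofReal

lemma tiltDensity_ne_zero (p : EuclideanSpace ℝ (Fin n) × EuclideanSpace ℝ (Fin n)) :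
    tiltDensity j l d p ≠ 0 := by
  simp [tiltDensity, Real.exp_pos]

end

lemma integrable_of_lintegral_ofReal_le {α : Type*} [MeasurableSpace α] {π : Measure α}
    {g : α → ℝ} (hg : Measurable g) (h0 : ∀ x, 0 ≤ g x) {c : ℝ}
    (h : ∫⁻ x, ENNReal.ofReal (g x) ∂π ≤ ENNReal.ofReal c) : Integrable g π := by
  refine ⟨hg.aestronglyMeasurable, ?_⟩
  rw [hasFiniteIntegral_iff_ofReal (ae_of_all _ h0)]
  exact h.trans_lt ENNReal.ofReal_lt_top

/-- The integral of the tilt exponent under a joint law with first marginal `μ`. -/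
lemma integral_tiltExponent {μ : Measure (EuclideanSpace ℝ (Fin n))}
    {π : Measure (EuclideanSpace ℝ (Fin n) × EuclideanSpace ℝ (Fin n))} [IsProbabilityMeasure π]
    {j : EuclideanSpace ℝ (Fin n) → ℝ} (l d : ℝ) (hj : Integrable j μ) (hfst : π.fst = μ)
    (hdist : Integrable (fun p : EuclideanSpace ℝ (Fin n) × EuclideanSpace ℝ (Fin n) =>
      distortion p.1 p.2) π) :
    Integrable (tiltExponent j l d) π ∧
      ∫ p, tiltExponent j l d p ∂π = ∫ x, j x ∂μ + l * d - l * ∫ p, distortion p.1 p.2 ∂π := by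
  have hj' : Integrable (fun p : EuclideanSpace ℝ (Fin n) × EuclideanSpace ℝ (Fin n) =>
      j p.1) π := by
    rw [← hfst, Measure.fst] at hj
    exact hj.comp_measurable measurable_fst
  have hint : ∫ p, j p.1 ∂π = ∫ x, j x ∂μ := by
    rw [← hfst, Measure.fst, integral_map measurable_fst.aemeasurable]
    rw [← hfst] at hj
    exact hj.aestronglyMeasurable
  have h1 : Integrable (fun p : EuclideanSpace ℝ (Fin n) × EuclideanSpace ℝ (Fin n) =>
      j p.1 + l * d) π := hj'.add (integrable_const _)
  refine ⟨h1.sub (hdist.const_mul l), ?_⟩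
  unfold tiltExponent
  rw [integral_sub h1 (hdist.const_mul l), integral_add hj' (integrable_const _), hint]
  simp [integral_const_mul]

/-- The log-likelihood ratio with respect to a reweighted reference measure. -/
lemma llr_withDensity_exp_right {α : Type*} [MeasurableSpace α] {π τ : Measure α} [SigmaFinite π]
    [SigmaFinite τ] (h : π ≪ τ) {f : α → ℝ} (hf : Measurable f) :
    llr π (τ.withDensity fun x => ENNReal.ofReal (Real.exp (f x))) =ᵐ[π]
      fun x => llr π τ x - f x := by
  have h1 := Measure.rnDeriv_withDensity_right π τ
    (f := fun x => ENNReal.ofReal (Real.exp (f x)))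
    (hf.exp.ennreal_ofReal.aemeasurable) (ae_of_all _ fun x => by simp [Real.exp_pos])
    (ae_of_all _ fun x => by simp)
  filter_upwards [h.ae_le h1, Measure.rnDeriv_pos h, h.ae_le (Measure.rnDeriv_lt_top π τ)]
    with x hx hpos htop
  rw [llr, hx, ENNReal.toReal_mul, Real.log_mul, llr, ENNReal.toReal_inv,
    ENNReal.toReal_ofReal (Real.exp_pos _).le, Real.log_inv, Real.log_exp]
  · ring
  · simp [ENNReal.toReal_ofReal (Real.exp_pos _).le, Real.exp_ne_zero]
  · exact (ENNReal.toReal_pos hpos.ne' htop.ne).ne'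

lemma llr_withDensity_exp_left {α : Type*} [MeasurableSpace α] {τ : Measure α} [SigmaFinite τ]
    {f : α → ℝ} (hf : Measurable f) :
    llr (τ.withDensity fun x => ENNReal.ofReal (Real.exp (f x))) τ
      =ᵐ[τ.withDensity fun x => ENNReal.ofReal (Real.exp (f x))] f := by
  have h1 := Measure.rnDeriv_withDensity τ (hf.exp.ennreal_ofReal)
  filter_upwards [(withDensity_absolutelyContinuous τ _).ae_le h1] with x hx
  rw [llr, hx, ENNReal.toReal_ofReal (Real.exp_pos _).le, Real.log_exp]

namespace IsTiltCertificate

variable {μ ν : Measure (EuclideanSpace ℝ (Fin n))} {d l : ℝ} {j : EuclideanSpace ℝ (Fin n) → ℝ}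
  [IsProbabilityMeasure μ]

/-- Here the inequality `lintegral_fst_le` at every `v` is needed: the output law of a competing
channel is arbitrary and may charge points that `ν` does not. -/
lemma withDensity_univ_le (h : IsTiltCertificate μ d l j ν)
    (τ : Measure (EuclideanSpace ℝ (Fin n))) [IsProbabilityMeasure τ] :
    (μ.prod τ).withDensity (tiltDensity j l d) Set.univ ≤ 1 := by
  rw [withDensity_apply _ MeasurableSet.univ, Measure.restrict_univ,
    lintegral_prod_symm _ (measurable_tiltDensity h.continuous).aemeasurable]
  calc _ ≤ ∫⁻ _, 1 ∂τ := lintegral_mono fun v => h.lintegral_fst_le v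
    _ = 1 := by simp

/-- Change of reference measure: the log-likelihood ratio against the tilted product differs from
the original one by the tilt exponent. The divergence term is kept in the bound because its
vanishing later characterizes the minimizers. -/
lemma le_mutualInfo (h : IsTiltCertificate μ d l j ν)
    {κ : Kernel (EuclideanSpace ℝ (Fin n)) (EuclideanSpace ℝ (Fin n))} [IsMarkovKernel κ]
    (hI : mutualInfo μ κ ≠ ∞) {d' : ℝ} (hd' : 0 ≤ d')
    (hκ : expectedDistortion μ κ ≤ ENNReal.ofReal d') :
    InformationTheory.klDiv (μ.compProd κ)
        ((μ.prod (μ.bind κ)).withDensity (tiltDensity j l d)) ≠ ∞ ∧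
      ∫ x, j x ∂μ - l * (d' - d) + (InformationTheory.klDiv (μ.compProd κ)
        ((μ.prod (μ.bind κ)).withDensity (tiltDensity j l d))).toReal
        ≤ (mutualInfo μ κ).toReal := by
  set π := μ.compProd κ with hπ
  set τ := μ.prod (μ.bind κ) with hτ
  set ρ := τ.withDensity (tiltDensity j l d) with hρ
  have : IsProbabilityMeasure (μ.bind κ) := by infer_instance
  obtain ⟨hac, hint⟩ : π ≪ τ ∧ Integrable (llr π τ) π := InformationTheory.klDiv_ne_top_iff.1 hI
  have hρle : ρ Set.univ ≤ 1 := h.withDensity_univ_le (μ.bind κ)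
  have : IsFiniteMeasure ρ := ⟨hρle.trans_lt ENNReal.one_lt_top⟩
  have hac' : π ≪ ρ := hac.trans (withDensity_absolutelyContinuous'
    (measurable_tiltDensity h.continuous).aemeasurable (ae_of_all _ tiltDensity_ne_zero))
  rw [expectedDistortion_eq_lintegral_compProd] at hκ
  have hdint : Integrable (fun p : EuclideanSpace ℝ (Fin n) × EuclideanSpace ℝ (Fin n) =>
      distortion p.1 p.2) π :=
    integrable_of_lintegral_ofReal_le continuous_distortion.measurable
      (fun p => distortion_nonneg p.1 p.2) hκ
  have hdle : ∫ p, distortion p.1 p.2 ∂π ≤ d' := by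
    rw [← ofReal_integral_eq_lintegral_ofReal hdint
      (ae_of_all _ fun p => distortion_nonneg p.1 p.2)] at hκ
    exact (ENNReal.ofReal_le_ofReal_iff hd').1 hκ
  obtain ⟨hfint, hfeq⟩ := integral_tiltExponent (π := π) l d h.integrable
    (Measure.fst_compProd μ κ) hdint
  have hllr : llr π ρ =ᵐ[π] fun p => llr π τ p - tiltExponent j l d p :=
    llr_withDensity_exp_right hac (continuous_tiltExponent h.continuous).measurable
  have hllr_int : Integrable (llr π ρ) π := (integrable_congr hllr).2 (hint.sub hfint)
  refine ⟨InformationTheory.klDiv_ne_top hac' hllr_int, ?_⟩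
  have hI' : (mutualInfo μ κ).toReal = ∫ p, llr π τ p ∂π :=
    InformationTheory.toReal_klDiv_of_measure_eq hac (by simp)
  -- For measures of unequal mass the divergence contains the extra term `ρ(univ) - 1`, which is
  -- nonpositive and can be dropped.
  have hρreal : ρ.real Set.univ ≤ 1 :=
    ENNReal.toReal_le_of_le_ofReal zero_le_one (by simpa using hρle)
  rw [InformationTheory.toReal_klDiv hac' hllr_int, integral_congr_ae hllr,
    integral_sub hint hfint, hfeq, hI']
  simp only [probReal_univ]
  nlinarith [mul_le_mul_of_nonneg_left hdle h.slope_nonneg]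

/-- The tilted measure on `μ × ν` has marginals `μ` and `ν`, so its conditional kernel is a channel.
Its log-likelihood ratio is the tilt exponent, in which the two slope terms cancel on average
because the mean distortion is exactly `d`. -/
lemma exists_kernel [IsProbabilityMeasure ν] (h : IsTiltCertificate μ d l j ν) :
    ∃ κ : Kernel (EuclideanSpace ℝ (Fin n)) (EuclideanSpace ℝ (Fin n)), IsMarkovKernel κ ∧
      expectedDistortion μ κ ≤ ENNReal.ofReal d ∧
      mutualInfo μ κ = ENNReal.ofReal (∫ x, j x ∂μ) := by
  have hm := measurable_tiltDensity (l := l) (d := d) h.continuous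
  set τ := μ.prod ν with hτ
  set ρ := τ.withDensity (tiltDensity j l d) with hρ
  have hfst : ρ.fst = μ := by
    ext A hA
    rw [Measure.fst_apply hA, hρ, withDensity_apply _ (measurable_fst hA),
      ← lintegral_indicator (measurable_fst hA), hτ, lintegral_prod]
    · have : ∀ x, ∫⁻ v, (Prod.fst ⁻¹' A).indicator (tiltDensity j l d) (x, v) ∂ν
          = A.indicator 1 x := by
        intro x
        by_cases hx : x ∈ A
        · simp [Set.indicator, hx, h.lintegral_snd_eq x]
        · simp [Set.indicator, hx]
      simp_rw [this]
      simp [lintegral_indicator_one hA]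
    · exact (hm.indicator (measurable_fst hA)).aemeasurable
  have hsnd : ρ.snd = ν := by
    ext A hA
    rw [Measure.snd_apply hA, hρ, withDensity_apply _ (measurable_snd hA),
      ← lintegral_indicator (measurable_snd hA), hτ, lintegral_prod_symm]
    · have : ∀ᵐ v ∂ν, ∫⁻ x, (Prod.snd ⁻¹' A).indicator (tiltDensity j l d) (x, v) ∂μ
          = A.indicator 1 v := by
        filter_upwards [h.lintegral_fst_eq] with v hv
        by_cases hx : v ∈ A
        · simp [Set.indicator, hx, hv]
        · simp [Set.indicator, hx]
      rw [lintegral_congr_ae this]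
      simp [lintegral_indicator_one hA]
    · exact (hm.indicator (measurable_snd hA)).aemeasurable
  have : IsProbabilityMeasure ρ := by
    constructor
    rw [← Measure.fst_univ, hfst, measure_univ]
  have hcomp : μ.compProd ρ.condKernel = ρ := by
    conv_rhs => rw [← ρ.disintegrate ρ.condKernel, hfst]
  have hbind : μ.bind ρ.condKernel = ν := by
    rw [← Measure.snd_compProd, hcomp, hsnd]
  have hdist : ∫⁻ p, ENNReal.ofReal (distortion p.1 p.2) ∂ρ = ENNReal.ofReal d := by
    rw [hρ, lintegral_withDensity_eq_lintegral_mul _ hm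
      continuous_distortion.measurable.ennreal_ofReal, hτ, lintegral_prod_symm]
    · exact h.lintegral_dist
    · exact (hm.mul continuous_distortion.measurable.ennreal_ofReal).aemeasurable
  have hdint : Integrable (fun p : EuclideanSpace ℝ (Fin n) × EuclideanSpace ℝ (Fin n) =>
      distortion p.1 p.2) ρ :=
    integrable_of_lintegral_ofReal_le continuous_distortion.measurable
      (fun p => distortion_nonneg p.1 p.2) hdist.le
  have hdeq : ∫ p, distortion p.1 p.2 ∂ρ = d := by
    have hnn : 0 ≤ᵐ[ρ] fun p : EuclideanSpace ℝ (Fin n) × EuclideanSpace ℝ (Fin n) =>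
      distortion p.1 p.2 := ae_of_all ρ fun p => distortion_nonneg p.1 p.2
    rw [integral_eq_lintegral_of_nonneg_ae hnn hdint.aestronglyMeasurable, hdist,
      ENNReal.toReal_ofReal h.dist_nonneg]
  obtain ⟨hfint, hfeq⟩ := integral_tiltExponent (π := ρ) l d h.integrable hfst hdint
  have hllr : llr ρ τ =ᵐ[ρ] tiltExponent j l d := by
    rw [hρ, tiltDensity_def]
    exact llr_withDensity_exp_left (continuous_tiltExponent h.continuous).measurable
  refine ⟨ρ.condKernel, inferInstance, ?_, ?_⟩
  · rw [expectedDistortion_eq_lintegral_compProd, hcomp, hdist]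
  · have hac : ρ ≪ τ := withDensity_absolutelyContinuous τ _
    have hint : Integrable (llr ρ τ) ρ := (integrable_congr hllr).2 hfint
    rw [mutualInfo, hcomp, hbind, InformationTheory.klDiv_of_ac_of_integrable hac hint,
      integral_congr_ae hllr, hfeq, hdeq, probReal_univ, probReal_univ]
    congr 1
    ring

lemma infMutualInfo_eq [IsProbabilityMeasure ν] (h : IsTiltCertificate μ d l j ν) :
    infMutualInfo μ d = ENNReal.ofReal (∫ x, j x ∂μ) := by
  refine le_antisymm ?_ ?_
  · obtain ⟨κ, h1, h2, h3⟩ := h.exists_kernel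
    rw [← h3]
    exact iInf_le_of_le κ (iInf_le_of_le h1 (iInf_le _ h2))
  · refine le_iInf fun κ => le_iInf fun h1 => le_iInf fun h2 => ?_
    by_cases hI : mutualInfo μ κ = ∞
    · simp [hI]
    · have := (h.le_mutualInfo hI h.dist_nonneg h2).2
      rw [sub_self, mul_zero, sub_zero] at this
      rw [← ENNReal.ofReal_toReal hI]
      exact ENNReal.ofReal_le_ofReal ((le_add_of_nonneg_right ENNReal.toReal_nonneg).trans this)

lemma exists_isRDFAchieving [IsProbabilityMeasure ν] (h : IsTiltCertificate μ d l j ν) :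
    ∃ κ, IsRDFAchieving μ d κ := by
  obtain ⟨κ, h1, h2, h3⟩ := h.exists_kernel
  exact ⟨κ, h1, h2, by rw [h3, h.infMutualInfo_eq]⟩

/-- Subgradient inequality: the lower bound from the certificate at `d` is tested on the optimal
channel of the certificate at `d'`. -/
lemma sub_le_integral {d' l' : ℝ} {j' : EuclideanSpace ℝ (Fin n) → ℝ}
    {ν' : Measure (EuclideanSpace ℝ (Fin n))} [IsProbabilityMeasure ν']
    (h : IsTiltCertificate μ d l j ν) (h' : IsTiltCertificate μ d' l' j' ν')
    (h0 : 0 ≤ ∫ x, j' x ∂μ) :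
    ∫ x, j x ∂μ - l * (d' - d) ≤ ∫ x, j' x ∂μ := by
  obtain ⟨κ, h1, h2, h3⟩ := h'.exists_kernel
  have := (h.le_mutualInfo (by rw [h3]; exact ENNReal.ofReal_ne_top) h'.dist_nonneg h2).2
  rw [h3, ENNReal.toReal_ofReal h0] at this
  exact (le_add_of_nonneg_right ENNReal.toReal_nonneg).trans this

/-- The formula for the tilted information in terms of any optimal kernel. -/
lemma eq_of_isRDFAchieving [IsProbabilityMeasure ν] [μ.IsOpenPosMeasure]
    (h : IsTiltCertificate μ d l j ν)
    (h0 : 0 ≤ ∫ x, j x ∂μ)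
    {κ : Kernel (EuclideanSpace ℝ (Fin n)) (EuclideanSpace ℝ (Fin n))}
    (hκ : IsRDFAchieving μ d κ) (x : EuclideanSpace ℝ (Fin n)) :
    -l * d - Real.log (∫ v, Real.exp (-l * distortion x v) ∂(μ.bind κ)) = j x := by
  have := hκ.isMarkov
  have hI : mutualInfo μ κ = ENNReal.ofReal (∫ x, j x ∂μ) := by
    rw [hκ.mutualInfo_eq, h.infMutualInfo_eq]
  have hne : mutualInfo μ κ ≠ ∞ := by rw [hI]; exact ENNReal.ofReal_ne_top
  obtain ⟨hk1, hk2⟩ := h.le_mutualInfo hne h.dist_nonneg hκ.expectedDistortion_le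
  have hm := measurable_tiltDensity (l := l) (d := d) h.continuous
  have : IsFiniteMeasure ((μ.prod (μ.bind κ)).withDensity (tiltDensity j l d)) :=
    ⟨(h.withDensity_univ_le (μ.bind κ)).trans_lt ENNReal.one_lt_top⟩
  rw [hI, ENNReal.toReal_ofReal h0, sub_self, mul_zero, sub_zero] at hk2
  -- Optimality leaves no room for the divergence term, so the optimal joint law is the tilted
  -- product of its own marginals.
  have hk3 : InformationTheory.klDiv (μ.compProd κ)
      ((μ.prod (μ.bind κ)).withDensity (tiltDensity j l d)) = 0 := by
    have h4 := ENNReal.toReal_nonneg (a := InformationTheory.klDiv (μ.compProd κ)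
      ((μ.prod (μ.bind κ)).withDensity (tiltDensity j l d)))
    have h5 : (InformationTheory.klDiv (μ.compProd κ)
      ((μ.prod (μ.bind κ)).withDensity (tiltDensity j l d))).toReal = 0 := by linarith
    exact ((ENNReal.toReal_eq_zero_iff _).1 h5).resolve_right hk1
  have heq := InformationTheory.klDiv_eq_zero_iff.1 hk3
  -- Comparison of first marginals: that of the joint law is `μ`, so the tilt density must integrate
  -- to one over the actual output law.
  have hmarg : (fun x => ∫⁻ v, tiltDensity j l d (x, v) ∂(μ.bind κ)) =ᵐ[μ] fun _ => 1 := by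
    refine ae_eq_of_forall_setLIntegral_eq_of_sigmaFinite hm.lintegral_prod_right'
      measurable_const fun A hA _ => ?_
    have h1 : (μ.compProd κ) (Prod.fst ⁻¹' A) = μ A := by
      rw [← Measure.fst_apply hA, Measure.fst_compProd]
    rw [setLIntegral_const, one_mul, ← h1, heq, withDensity_apply _ (measurable_fst hA)]
    have : Prod.fst ⁻¹' A = A ×ˢ (Set.univ : Set (EuclideanSpace ℝ (Fin n))) := by
      ext; simp
    rw [this, setLIntegral_prod _ hm.aemeasurable]
    simp
  have hcont : Continuous fun x => ∫ v, Real.exp (-l * distortion x v) ∂(μ.bind κ) := by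
    refine continuous_of_dominated (bound := fun _ => 1) (fun x => ?_)
      (fun x => ae_of_all _ fun v => ?_) (integrable_const _) (ae_of_all _ fun v => ?_)
    · exact (by unfold distortion; fun_prop :
        Continuous fun v => Real.exp (-l * distortion x v)).aestronglyMeasurable
    · rw [Real.norm_of_nonneg (Real.exp_pos _).le, Real.exp_le_one_iff]
      nlinarith [mul_nonneg h.slope_nonneg (distortion_nonneg x v)]
    · unfold distortion; fun_prop
  have hint : ∀ x, Integrable (fun v => Real.exp (-l * distortion x v)) (μ.bind κ) := fun x => by
    refine Integrable.of_bound (C := 1)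
      (by unfold distortion; fun_prop :
        Continuous fun v => Real.exp (-l * distortion x v)).aestronglyMeasurable
      (ae_of_all _ fun v => ?_)
    rw [Real.norm_of_nonneg (Real.exp_pos _).le, Real.exp_le_one_iff]
    nlinarith [mul_nonneg h.slope_nonneg (distortion_nonneg x v)]
  have hpt : (fun x => Real.exp (j x + l * d) * ∫ v, Real.exp (-l * distortion x v) ∂(μ.bind κ))
      =ᵐ[μ] fun _ => 1 := by
    filter_upwards [hmarg] with x hx
    have h1 : ∀ v, tiltDensity j l d (x, v)
        = ENNReal.ofReal (Real.exp (j x + l * d) * Real.exp (-l * distortion x v)) := fun v => by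
      rw [tiltDensity, tiltExponent, ← Real.exp_add]; ring_nf
    simp_rw [h1] at hx
    rw [← ofReal_integral_eq_lintegral_ofReal ((hint x).const_mul _)
      (ae_of_all _ fun v => by positivity), integral_const_mul, ENNReal.ofReal_eq_one] at hx
    exact hx
  -- Both sides are continuous and `μ` charges every open set, so the almost-everywhere identity
  -- holds at every point.
  have hall := ((Continuous.mul (by have := h.continuous; fun_prop) hcont).ae_eq_iff_eq μ
    continuous_const).1 hpt
  have hx := congrFun hall x
  simp only [Pi.mul_apply] at hx
  have hpos : 0 < ∫ v, Real.exp (-l * distortion x v) ∂(μ.bind κ) := integral_exp_pos (hint x)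
  have := congrArg Real.log hx
  rw [Real.log_mul (Real.exp_ne_zero _) hpos.ne', Real.log_exp, Real.log_one] at this
  linarith

end IsTiltCertificate

/-- Certificates with continuously varying slope give the derivative of the rate-distortion
function. -/
lemma hasDerivAt_rdf {μ : Measure (EuclideanSpace ℝ (Fin n))} [IsProbabilityMeasure μ]
    {I : Set ℝ} {d : ℝ} (hI : I ∈ nhds d) (l : ℝ → ℝ) (hl : ContinuousAt l d)
    (j : ℝ → EuclideanSpace ℝ (Fin n) → ℝ) (ν : ℝ → Measure (EuclideanSpace ℝ (Fin n)))
    (hν : ∀ t ∈ I, IsProbabilityMeasure (ν t))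
    (h : ∀ t ∈ I, IsTiltCertificate μ t (l t) (j t) (ν t))
    (h0 : ∀ t ∈ I, 0 ≤ ∫ x, j t x ∂μ) :
    HasDerivAt (rdf μ) (-(l d / n)) d := by
  have hd : d ∈ I := mem_of_mem_nhds hI
  set φ : ℝ → ℝ := fun t => (infMutualInfo μ t).toReal with hφ
  have hφeq : ∀ t ∈ I, φ t = ∫ x, j t x ∂μ := fun t ht => by
    have := hν t ht
    simp only [hφ, (h t ht).infMutualInfo_eq, ENNReal.toReal_ofReal (h0 t ht)]
  have hsub : ∀ t ∈ I, ∀ t' ∈ I, φ t - l t * (t' - t) ≤ φ t' := fun t ht t' ht' => by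
    have := hν t ht
    have := hν t' ht'
    rw [hφeq t ht, hφeq t' ht']
    exact (h t ht).sub_le_integral (h t' ht') (h0 t' ht')
  have hφd : HasDerivAt φ (-l d) d := by
    rw [hasDerivAt_iff_isLittleO, Asymptotics.isLittleO_iff]
    intro c hc
    have hlc : ∀ᶠ t in nhds d, |l t - l d| < c := by
      have := Metric.continuousAt_iff'.1 hl c hc
      simpa [Real.dist_eq] using this
    filter_upwards [hI, hlc] with t ht hlt
    -- The subgradients at `d` and at `t` trap the first-order remainder between `0` and `(l d - l
    -- t) * (t - d)`, which is `o(t - d)` by continuity of the slope.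
    have h1 := hsub d hd t ht
    have h2 := hsub t ht d hd
    have h3 : 0 ≤ φ t - φ d - (t - d) • (-l d) := by simp only [smul_eq_mul]; linarith
    rw [Real.norm_of_nonneg h3, Real.norm_eq_abs]
    calc φ t - φ d - (t - d) • (-l d) ≤ (l d - l t) * (t - d) := by
          simp only [smul_eq_mul]; linarith
      _ ≤ |(l d - l t) * (t - d)| := le_abs_self _
      _ = |l t - l d| * |t - d| := by rw [abs_mul, abs_sub_comm]
      _ ≤ c * |t - d| := by gcongr
  have h1 : HasDerivAt (rdf μ) (1 / (n : ℝ) * -l d) d := hφd.const_mul (1 / (n : ℝ))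
  rwa [show 1 / (n : ℝ) * -l d = -(l d / n) by ring] at h1

end TiltedInformation

/-! ### The tilt of one Gaussian coordinate and Gaussian moments. -/

section GaussianCoordinate

/-- The tilt exponent of a single Gaussian coordinate of variance `s` at water level `θ`. -/
noncomputable def gaussianTilt (θ s : ℝ≥0) (x v : ℝ) : ℝ :=
  min (θ : ℝ) s / (2 * θ) * (x ^ 2 / s) + 1 / 2 * Real.log (max (θ : ℝ) s / θ)
    - (x - v) ^ 2 / (2 * θ)

lemma measurable_gaussianTilt_left (θ s : ℝ≥0) (v : ℝ) :
    Measurable fun x => gaussianTilt θ s x v := by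
  unfold gaussianTilt; fun_prop

lemma measurable_gaussianTilt_right (θ s : ℝ≥0) (x : ℝ) :
    Measurable fun v => gaussianTilt θ s x v := by
  unfold gaussianTilt; fun_prop

variable {θ s : ℝ≥0}

/-- Below the water level the squares of `x` cancel. What remains is linear in `x`, hence integrable
by the moment generating function, and vanishes at the only output used, `v = 0`. -/
lemma gaussianTilt_of_le (hθ : 0 < θ) (hs : 0 < s) (h : s ≤ θ) (x v : ℝ) :
    gaussianTilt θ s x v = v / θ * x - v ^ 2 / (2 * θ) := by
  have hθ' : (0 : ℝ) < θ := hθ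
  have hs' : (0 : ℝ) < s := hs
  have h' : (s : ℝ) ≤ θ := h
  rw [gaussianTilt, min_eq_right h', max_eq_left h', div_self hθ'.ne', Real.log_one]
  field_simp
  ring

/-- The backward channel above the water level: given the output `v`, the source is `N(v, θ)`. -/
lemma gaussianPDFReal_mul_exp_gaussianTilt (hθ : 0 < θ) (h : θ < s) (x v : ℝ) :
    gaussianPDFReal 0 s x * Real.exp (gaussianTilt θ s x v) = gaussianPDFReal v θ x := by
  have hθ' : (0 : ℝ) < θ := hθ
  have h' : (θ : ℝ) < s := h
  have hs' : (0 : ℝ) < s := hθ'.trans h'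
  have hlog : Real.exp (1 / 2 * Real.log (s / θ)) = √(s / θ) := by
    rw [mul_comm, ← Real.rpow_def_of_pos (by positivity), Real.sqrt_eq_rpow]
  have hexp : -(x - 0) ^ 2 / (2 * s) + ((θ : ℝ) / (2 * θ) * (x ^ 2 / s) - (x - v) ^ 2 / (2 * θ))
      = -(x - v) ^ 2 / (2 * θ) := by
    field_simp
    ring
  have hc : (√(2 * Real.pi * s))⁻¹ * √(s / θ) = (√(2 * Real.pi * θ))⁻¹ := by
    rw [← Real.sqrt_inv, ← Real.sqrt_inv, ← Real.sqrt_mul (by positivity)]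
    congr 1
    field_simp
  rw [gaussianPDFReal, gaussianPDFReal, gaussianTilt, min_eq_left h'.le, max_eq_right h'.le,
    ← hexp, ← hc, ← hlog, add_sub_right_comm, Real.exp_add, Real.exp_add]
  ring

lemma lintegral_exp_gaussianTilt_mul (hθ : 0 < θ) (h : θ < s) (v : ℝ) {g : ℝ → ℝ≥0∞}
    (hg : Measurable g) :
    ∫⁻ x, ENNReal.ofReal (Real.exp (gaussianTilt θ s x v)) * g x ∂gaussianReal 0 s
      = ∫⁻ x, g x ∂gaussianReal v θ := by
  rw [gaussianReal_of_var_ne_zero _ (hθ.trans h).ne', gaussianReal_of_var_ne_zero _ hθ.ne',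
    lintegral_withDensity_eq_lintegral_mul _ (measurable_gaussianPDF _ _)
      (g := fun x => ENNReal.ofReal (Real.exp (gaussianTilt θ s x v)) * g x)
      ((measurable_gaussianTilt_left θ s v).exp.ennreal_ofReal.mul hg),
    lintegral_withDensity_eq_lintegral_mul _ (measurable_gaussianPDF _ _) hg]
  refine lintegral_congr fun x => ?_
  simp only [Pi.mul_apply]
  rw [gaussianPDF, gaussianPDF, ← gaussianPDFReal_mul_exp_gaussianTilt hθ h x v,
    ENNReal.ofReal_mul (gaussianPDFReal_nonneg _ _ _), mul_assoc]

lemma lintegral_ofReal_sub_sq_gaussianReal (v : ℝ) (s : ℝ≥0) :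
    ∫⁻ x, ENNReal.ofReal ((x - v) ^ 2) ∂gaussianReal v s = ENNReal.ofReal s := by
  have h := variance_fun_id_gaussianReal (μ := v) (v := s)
  have hm : MemLp (fun x : ℝ => x) 2 (gaussianReal v s) := memLp_id_gaussianReal 2
  rw [← h, variance, ENNReal.ofReal_toReal (evariance_ne_top hm), evariance_eq_lintegral_ofReal]
  simp

/-- Above the level the integral is the mass of `N(v, θ)`. Below it, the moment generating function
gives the exponent `-(θ - s) v² / (2θ²) ≤ 0`. -/
lemma lintegral_exp_gaussianTilt_le_one (hθ : 0 < θ) (hs : 0 < s) (v : ℝ) :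
    ∫⁻ x, ENNReal.ofReal (Real.exp (gaussianTilt θ s x v)) ∂gaussianReal 0 s ≤ 1 := by
  rcases lt_or_ge θ s with h | h
  · have := lintegral_exp_gaussianTilt_mul hθ h v (g := 1) measurable_one
    simp only [Pi.one_apply, mul_one, lintegral_one, measure_univ] at this
    exact this.le
  · have hθ' : (0 : ℝ) < θ := hθ
    have h' : (s : ℝ) ≤ θ := h
    have hmgf := congrFun (mgf_fun_id_gaussianReal (μ := 0) (v := s)) (v / θ)
    simp only [mgf] at hmgf
    have hint : Integrable (fun x => Real.exp (v / θ * x)) (gaussianReal 0 s) :=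
      integrable_exp_mul_gaussianReal _
    simp_rw [gaussianTilt_of_le hθ hs h, Real.exp_sub]
    rw [← ofReal_integral_eq_lintegral_ofReal (hint.div_const _)
      (ae_of_all _ fun x => by positivity), integral_div, hmgf, ← Real.exp_sub]
    rw [ENNReal.ofReal_le_one, Real.exp_le_one_iff]
    have : (0 : ℝ) * (v / θ) + s * (v / θ) ^ 2 / 2 - v ^ 2 / (2 * θ)
        = -((θ - s) * v ^ 2 / (2 * θ ^ 2)) := by
      field_simp
      ring
    rw [this, neg_nonpos]
    have : (0 : ℝ) ≤ θ - s := sub_nonneg.2 h'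
    positivity

/-- The subtraction `s - θ` is truncated in `ℝ≥0`: below the level the output law degenerates to the
Dirac mass at `0`, which is why equality is only needed almost everywhere. -/
lemma lintegral_exp_gaussianTilt_mul_eq (hθ : 0 < θ) (hs : 0 < s) :
    ∀ᵐ v ∂gaussianReal 0 (s - θ),
      ∫⁻ x, ENNReal.ofReal (Real.exp (gaussianTilt θ s x v)) ∂gaussianReal 0 s = 1 ∧
      ∫⁻ x, ENNReal.ofReal (Real.exp (gaussianTilt θ s x v)) * ENNReal.ofReal ((x - v) ^ 2)
        ∂gaussianReal 0 s = ENNReal.ofReal (min θ s) := by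
  rcases lt_or_ge θ s with h | h
  · refine ae_of_all _ fun v => ⟨?_, ?_⟩
    · have := lintegral_exp_gaussianTilt_mul hθ h v (g := 1) measurable_one
      simpa using this
    · rw [lintegral_exp_gaussianTilt_mul hθ h v (g := fun x => ENNReal.ofReal ((x - v) ^ 2))
        (by fun_prop), lintegral_ofReal_sub_sq_gaussianReal,
        min_eq_left (NNReal.coe_le_coe.2 h.le)]
  · rw [tsub_eq_zero_of_le h, gaussianReal_zero_var, ae_dirac_eq, Filter.eventually_pure]
    have h0 : ∀ x, gaussianTilt θ s x 0 = 0 := fun x => by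
      rw [gaussianTilt_of_le hθ hs h]; simp
    refine ⟨by simp [h0], ?_⟩
    simp only [h0, Real.exp_zero, ENNReal.ofReal_one, one_mul]
    rw [lintegral_ofReal_sub_sq_gaussianReal, min_eq_right (NNReal.coe_le_coe.2 h)]

/-- The forward channel: completing the square in `v` produces the density of `N(x(s - θ)/s, θ(s -
θ)/s)`, the law of the output given `x`. -/
lemma lintegral_exp_gaussianTilt_right (hθ : 0 < θ) (hs : 0 < s) (x : ℝ) :
    ∫⁻ v, ENNReal.ofReal (Real.exp (gaussianTilt θ s x v)) ∂gaussianReal 0 (s - θ) = 1 := by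
  rcases lt_or_ge θ s with h | h
  · have hθ' : (0 : ℝ) < θ := hθ
    have h' : (θ : ℝ) < s := h
    have hs' : (0 : ℝ) < s := hs
    have hd' : (0 : ℝ) < s - θ := sub_pos.2 h'
    have hd : s - θ ≠ 0 := (tsub_pos_of_lt h).ne'
    have hcoe : ((s - θ : ℝ≥0) : ℝ) = s - θ := NNReal.coe_sub h.le
    have hv : θ * (s - θ) / s ≠ 0 := by positivity
    rw [gaussianReal_of_var_ne_zero _ hd, lintegral_withDensity_eq_lintegral_mul _
      (measurable_gaussianPDF _ _) (measurable_gaussianTilt_right θ s x).exp.ennreal_ofReal,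
      ← lintegral_gaussianPDF_eq_one (x * (s - θ) / s) hv]
    refine lintegral_congr fun v => ?_
    have hlog : Real.exp (1 / 2 * Real.log (s / θ)) = √(s / θ) := by
      rw [mul_comm, ← Real.rpow_def_of_pos (by positivity), Real.sqrt_eq_rpow]
    have hexp : -(v - 0) ^ 2 / (2 * (s - θ))
        + ((θ : ℝ) / (2 * θ) * (x ^ 2 / s) - (x - v) ^ 2 / (2 * θ))
        = -(v - x * (s - θ) / s) ^ 2 / (2 * (θ * (s - θ) / s)) := by
      field_simp
      ring
    have hc : (√(2 * Real.pi * (s - θ)))⁻¹ * √(s / θ)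
        = (√(2 * Real.pi * (θ * (s - θ) / s)))⁻¹ := by
      rw [← Real.sqrt_inv, ← Real.sqrt_inv, ← Real.sqrt_mul (by positivity)]
      congr 1
      field_simp
    simp only [Pi.mul_apply]
    rw [gaussianPDF, gaussianPDF, ← ENNReal.ofReal_mul (gaussianPDFReal_nonneg _ _ _)]
    congr 1
    rw [gaussianPDFReal, gaussianPDFReal, gaussianTilt, min_eq_left h'.le, max_eq_right h'.le]
    push_cast
    rw [hcoe, ← hexp, ← hc, ← hlog, add_sub_right_comm, Real.exp_add, Real.exp_add]
    ring
  · rw [tsub_eq_zero_of_le h, gaussianReal_zero_var, lintegral_dirac,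
      gaussianTilt_of_le hθ hs h]
    simp

lemma integral_sq_gaussianReal_zero (s : ℝ≥0) : ∫ x, x ^ 2 ∂gaussianReal 0 s = s := by
  have h := variance_fun_id_gaussianReal (μ := 0) (v := s)
  rw [variance_eq_integral (by fun_prop)] at h
  simpa using h

/-- The fourth moment is the fourth derivative at `0` of the moment generating function; each
derivative is a polynomial times the same exponential. -/
lemma integral_pow_four_gaussianReal_zero (s : ℝ≥0) :
    ∫ x, x ^ 4 ∂gaussianReal 0 s = 3 * (s : ℝ) ^ 2 := by
  have h := iteratedDeriv_mgf_zero (X := id) (μ := gaussianReal 0 s)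
    (by simp [integrableExpSet_id_gaussianReal]) 4
  simp only [Pi.pow_apply, id] at h
  rw [← h, mgf_id_gaussianReal]
  have hE : ∀ t : ℝ, HasDerivAt (fun t : ℝ => Real.exp (0 * t + s * t ^ 2 / 2))
      (s * t * Real.exp (0 * t + s * t ^ 2 / 2)) t := fun t => by
    have h1 : HasDerivAt (fun t : ℝ => 0 * t + s * t ^ 2 / 2) (s * t) t := by
      have := ((hasDerivAt_pow 2 t).const_mul (s : ℝ)).div_const 2
      convert! ((hasDerivAt_id t).const_mul (0 : ℝ)).add this using 1
      simp
      ring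
    convert! h1.exp using 1
    ring
  have h1 : deriv (fun t : ℝ => Real.exp (0 * t + s * t ^ 2 / 2))
      = fun t => s * t * Real.exp (0 * t + s * t ^ 2 / 2) := funext fun t => (hE t).deriv
  have h2 : deriv (fun t : ℝ => s * t * Real.exp (0 * t + s * t ^ 2 / 2))
      = fun t => (s + s ^ 2 * t ^ 2) * Real.exp (0 * t + s * t ^ 2 / 2) := funext fun t => by
    have := ((hasDerivAt_id t).const_mul (s : ℝ)).mul (hE t)
    refine HasDerivAt.deriv ?_
    convert! this using 1
    simp
    ring
  have h3 : deriv (fun t : ℝ => (s + s ^ 2 * t ^ 2) * Real.exp (0 * t + s * t ^ 2 / 2))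
      = fun t => (3 * s ^ 2 * t + s ^ 3 * t ^ 3) * Real.exp (0 * t + s * t ^ 2 / 2) :=
    funext fun t => by
      have := (((hasDerivAt_pow 2 t).const_mul ((s : ℝ) ^ 2)).const_add (s : ℝ)).mul (hE t)
      refine HasDerivAt.deriv ?_
      convert! this using 1
      simp
      ring
  have h4 : deriv (fun t : ℝ => (3 * s ^ 2 * t + s ^ 3 * t ^ 3)
        * Real.exp (0 * t + s * t ^ 2 / 2)) 0 = 3 * (s : ℝ) ^ 2 := by
    have := (((hasDerivAt_id (0 : ℝ)).const_mul (3 * (s : ℝ) ^ 2)).add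
      ((hasDerivAt_pow 3 (0 : ℝ)).const_mul ((s : ℝ) ^ 3))).mul (hE 0)
    refine HasDerivAt.deriv ?_
    convert! this using 1
    simp
  rw [iteratedDeriv_succ, iteratedDeriv_succ, iteratedDeriv_succ, iteratedDeriv_one, h1, h2, h3,
    h4]

lemma memLp_sq_gaussianReal (s : ℝ≥0) : MemLp (fun x : ℝ => x ^ 2) 2 (gaussianReal 0 s) := by
  have h := memLp_id_gaussianReal' (μ := 0) (v := s) 4 (by simp)
  rw [memLp_two_iff_integrable_sq (by fun_prop)]
  have := h.integrable_norm_pow (p := 4) (by simp)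
  simpa [← pow_mul, Even.pow_abs (by decide : Even 4)] using this

lemma variance_sq_gaussianReal (s : ℝ≥0) :
    Var[fun x => x ^ 2; gaussianReal 0 s] = 2 * (s : ℝ) ^ 2 := by
  rw [variance_eq_sub (memLp_sq_gaussianReal s)]
  have : ((fun x : ℝ => x ^ 2) ^ 2) = fun x => x ^ 4 := by
    ext x; simp [← pow_mul]
  rw [this, integral_pow_four_gaussianReal_zero, integral_sq_gaussianReal_zero]
  ring

end GaussianCoordinate

lemma lintegral_pi_prod {ι : Type*} [Fintype ι] (m : ι → Measure ℝ)
    [∀ i, IsProbabilityMeasure (m i)] (g : ι → ℝ → ℝ≥0∞) (hg : ∀ i, Measurable (g i)) :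
    ∫⁻ x, ∏ i, g i (x i) ∂Measure.pi m = ∏ i, ∫⁻ x, g i x ∂m i := by
  have hind := iIndepFun_pi (μ := m) (X := g) fun i => (hg i).aemeasurable
  rw [lintegral_prod_eq_prod_lintegral_of_indepFun Finset.univ _ hind
    fun i => (hg i).comp (measurable_pi_apply i)]
  refine Finset.prod_congr rfl fun i _ => ?_
  exact (measurePreserving_eval m i).lintegral_comp (hg i)

/-! ### Gaussian vectors: the waterfilling certificate and its variance. -/

section GaussianVector

variable {n : ℕ}

/-- The coordinates of `ℝⁿ` with respect to the image of the standard basis under `e`. -/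
noncomputable def coordEquiv (e : EuclideanSpace ℝ (Fin n) ≃ₗᵢ[ℝ] EuclideanSpace ℝ (Fin n)) :
    (Fin n → ℝ) ≃ᵐ EuclideanSpace ℝ (Fin n) :=
  (MeasurableEquiv.toLp 2 (Fin n → ℝ)).trans e.toMeasurableEquiv

/-- The centered Gaussian law with independent components of variances `s` in the
coordinates `e`. -/
noncomputable def gaussianVec (e : EuclideanSpace ℝ (Fin n) ≃ₗᵢ[ℝ] EuclideanSpace ℝ (Fin n))
    (s : Fin n → ℝ≥0) : Measure (EuclideanSpace ℝ (Fin n)) :=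
  (Measure.pi fun i => gaussianReal 0 (s i)).map (coordEquiv e)

/-- The tilted information of `gaussianVec e s` at water level `θ`. -/
noncomputable def waterfillTilt (e : EuclideanSpace ℝ (Fin n) ≃ₗᵢ[ℝ] EuclideanSpace ℝ (Fin n))
    (s : Fin n → ℝ≥0) (θ : ℝ) (u : EuclideanSpace ℝ (Fin n)) : ℝ :=
  ∑ i, (min θ (s i) / (2 * θ) * ((e.symm u) i ^ 2 / s i - 1) + 1 / 2 * Real.log (max θ (s i) / θ))

variable (e : EuclideanSpace ℝ (Fin n) ≃ₗᵢ[ℝ] EuclideanSpace ℝ (Fin n)) (s : Fin n → ℝ≥0)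

lemma coordEquiv_apply (x : Fin n → ℝ) : coordEquiv e x = e (WithLp.toLp 2 x) := rfl

instance : IsProbabilityMeasure (gaussianVec e s) :=
  Measure.isProbabilityMeasure_map (coordEquiv e).measurable.aemeasurable

lemma isOpenPosMeasure_gaussianVec (hs : ∀ i, 0 < s i) : (gaussianVec e s).IsOpenPosMeasure := by
  have : ∀ i, (gaussianReal 0 (s i)).IsOpenPosMeasure := fun i =>
    (gaussianReal_absolutelyContinuous' 0 (hs i).ne').isOpenPosMeasure
  exact (e.continuous.comp (PiLp.continuous_toLp 2 _)).isOpenPosMeasure_map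
    (coordEquiv e).surjective

variable {s}

lemma waterfillTilt_coordEquiv (θ : ℝ) (x : Fin n → ℝ) :
    waterfillTilt e s θ (coordEquiv e x)
      = ∑ i, (min θ (s i) / (2 * θ) * (x i ^ 2 / s i - 1)
          + 1 / 2 * Real.log (max θ (s i) / θ)) := by
  simp [waterfillTilt, coordEquiv_apply]

lemma continuous_waterfillTilt (θ : ℝ) : Continuous (waterfillTilt e s θ) := by
  unfold waterfillTilt
  have := e.symm.continuous
  fun_prop

lemma distortion_coordEquiv (x v : Fin n → ℝ) :
    distortion (coordEquiv e x) (coordEquiv e v) = 1 / (n : ℝ) * ∑ i, (x i - v i) ^ 2 := by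
  rw [distortion, coordEquiv_apply, coordEquiv_apply, ← map_sub, e.norm_map,
    EuclideanSpace.real_norm_sq_eq]
  simp

variable {θ : ℝ≥0}

/-- Everything factorizes over coordinates because the slope is `n/(2θ)` and the distortion is the
waterfilling sum: the term `l * d` exactly absorbs the constants `-min(θ, sᵢ)/(2θ)` of
`waterfillTilt`. -/
lemma tiltDensity_coordEquiv (hn : 0 < n) (hθ : 0 < θ) (x v : Fin n → ℝ) :
    tiltDensity (waterfillTilt e s θ) (n / (2 * θ)) (1 / n * ∑ i, min (θ : ℝ) (s i))
        (coordEquiv e x, coordEquiv e v)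
      = ∏ i, ENNReal.ofReal (Real.exp (gaussianTilt θ (s i) (x i) (v i))) := by
  have hθ' : (0 : ℝ) < θ := hθ
  have hn' : (0 : ℝ) < n := Nat.cast_pos.2 hn
  rw [tiltDensity, ← ENNReal.ofReal_prod_of_nonneg fun i _ => (Real.exp_pos _).le,
    ← Real.exp_sum, tiltExponent, waterfillTilt_coordEquiv, distortion_coordEquiv]
  congr 2
  have h1 : (n : ℝ) / (2 * θ) * (1 / n * ∑ i, min (θ : ℝ) (s i))
      = ∑ i, min (θ : ℝ) (s i) / (2 * θ) := by
    rw [← Finset.sum_div]; field_simp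
  have h2 : (n : ℝ) / (2 * θ) * (1 / n * ∑ i, (x i - v i) ^ 2)
      = ∑ i, (x i - v i) ^ 2 / (2 * θ) := by
    rw [← Finset.sum_div]; field_simp
  rw [h1, h2, ← Finset.sum_add_distrib, ← Finset.sum_sub_distrib]
  refine Finset.sum_congr rfl fun i _ => ?_
  rw [gaussianTilt]
  ring

lemma memLp_sq_pi (i : Fin n) :
    MemLp (fun x : Fin n → ℝ => x i ^ 2) 2 (Measure.pi fun i => gaussianReal 0 (s i)) :=
  (memLp_sq_gaussianReal (s i)).comp_measurePreserving (measurePreserving_eval _ i)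

lemma integral_sq_pi (i : Fin n) :
    ∫ x : Fin n → ℝ, x i ^ 2 ∂(Measure.pi fun i => gaussianReal 0 (s i)) = s i := by
  have h := (measurePreserving_eval (fun i => gaussianReal 0 (s i)) i).map_eq
  rw [← integral_sq_gaussianReal_zero (s i), ← h, integral_map
    (measurable_pi_apply i).aemeasurable (by fun_prop)]

lemma integrable_waterfillTilt (θ : ℝ) :
    Integrable (waterfillTilt e s θ) (gaussianVec e s) := by
  rw [gaussianVec, (coordEquiv e).measurableEmbedding.integrable_map_iff]
  have : waterfillTilt e s θ ∘ coordEquiv e = fun x => ∑ i, (min θ (s i) / (2 * θ) *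
      (x i ^ 2 / s i - 1) + 1 / 2 * Real.log (max θ (s i) / θ)) :=
    funext fun x => waterfillTilt_coordEquiv e θ x
  rw [this]
  refine integrable_finsetSum _ fun i _ => ?_
  exact (((((memLp_sq_pi i).integrable (by norm_num)).div_const _).sub
    (integrable_const _)).const_mul _).add (integrable_const _)

lemma integral_waterfillTilt (hs : ∀ i, 0 < s i) (θ : ℝ) :
    ∫ u, waterfillTilt e s θ u ∂(gaussianVec e s)
      = ∑ i, 1 / 2 * Real.log (max θ (s i) / θ) := by
  have h1 : ∀ i, Integrable (fun x : Fin n → ℝ => min θ (s i) / (2 * θ) * (x i ^ 2 / s i - 1))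
      (Measure.pi fun i => gaussianReal 0 (s i)) := fun i =>
    (((((memLp_sq_pi i).integrable (by norm_num)).div_const _).sub
      (integrable_const _)).const_mul _)
  rw [gaussianVec, (coordEquiv e).measurableEmbedding.integral_map]
  simp_rw [waterfillTilt_coordEquiv]
  have h2 : ∀ i, Integrable (fun x : Fin n → ℝ => min θ (s i) / (2 * θ) * (x i ^ 2 / s i - 1)
      + 1 / 2 * Real.log (max θ (s i) / θ)) (Measure.pi fun i => gaussianReal 0 (s i)) :=
    fun i => (h1 i).add (integrable_const _)
  rw [integral_finsetSum _ fun i _ => h2 i]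
  refine Finset.sum_congr rfl fun i _ => ?_
  have hi : (s i : ℝ) ≠ 0 := NNReal.coe_ne_zero.2 (hs i).ne'
  rw [integral_add (h1 i) (integrable_const _), integral_const_mul,
    integral_sub (((memLp_sq_pi i).integrable (by norm_num)).div_const _) (integrable_const _),
    integral_div, integral_sq_pi]
  simp [hi]

lemma integral_waterfillTilt_nonneg (hs : ∀ i, 0 < s i) {θ : ℝ} (hθ : 0 < θ) :
    0 ≤ ∫ u, waterfillTilt e s θ u ∂(gaussianVec e s) := by
  rw [integral_waterfillTilt e hs]
  refine Finset.sum_nonneg fun i _ => mul_nonneg (by norm_num) (Real.log_nonneg ?_)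
  rw [le_div_iff₀ hθ, one_mul]
  exact le_max_left _ _

/-- Reverse waterfilling: the optimal output has variances `(sᵢ - θ)⁺`, and each condition reduces
to the one-coordinate case through the product structure. -/
lemma isTiltCertificate_gaussianVec (hn : 0 < n) (hs : ∀ i, 0 < s i) (hθ : 0 < θ) :
    IsTiltCertificate (gaussianVec e s) (1 / n * ∑ i, min (θ : ℝ) (s i)) (n / (2 * θ))
      (waterfillTilt e s θ) (gaussianVec e fun i => s i - θ) where
  slope_nonneg := by positivity
  dist_nonneg := by positivity
  continuous := continuous_waterfillTilt e θ
  integrable := integrable_waterfillTilt e θ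
  lintegral_fst_le v := by
    obtain ⟨v, rfl⟩ := (coordEquiv e).surjective v
    rw [gaussianVec, lintegral_map_equiv]
    simp_rw [tiltDensity_coordEquiv e hn hθ]
    rw [lintegral_pi_prod _ (fun i x => ENNReal.ofReal (Real.exp (gaussianTilt θ (s i) x (v i))))
      fun i => (measurable_gaussianTilt_left θ (s i) (v i)).exp.ennreal_ofReal]
    exact Finset.prod_le_one' fun i _ => lintegral_exp_gaussianTilt_le_one hθ (hs i) (v i)
  lintegral_fst_eq := by
    rw [gaussianVec, gaussianVec, (coordEquiv e).measurableEmbedding.ae_map_iff]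
    have h : ∀ᵐ v ∂(Measure.pi fun i => gaussianReal 0 (s i - θ)), ∀ i, _ := ae_all_iff.2 fun i =>
      (measurePreserving_eval (fun i => gaussianReal 0 (s i - θ)) i).quasiMeasurePreserving.ae
        (lintegral_exp_gaussianTilt_mul_eq hθ (hs i))
    filter_upwards [h] with v hv
    rw [lintegral_map_equiv]
    simp_rw [tiltDensity_coordEquiv e hn hθ]
    rw [lintegral_pi_prod _ (fun i x => ENNReal.ofReal (Real.exp (gaussianTilt θ (s i) x (v i))))
      fun i => (measurable_gaussianTilt_left θ (s i) (v i)).exp.ennreal_ofReal]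
    exact Finset.prod_eq_one fun i _ => (hv i).1
  lintegral_snd_eq x := by
    obtain ⟨x, rfl⟩ := (coordEquiv e).surjective x
    rw [gaussianVec, lintegral_map_equiv]
    simp_rw [tiltDensity_coordEquiv e hn hθ]
    rw [lintegral_pi_prod _ (fun i v => ENNReal.ofReal (Real.exp (gaussianTilt θ (s i) (x i) v)))
      fun i => (measurable_gaussianTilt_right θ (s i) (x i)).exp.ennreal_ofReal]
    exact Finset.prod_eq_one fun i _ => lintegral_exp_gaussianTilt_right hθ (hs i) (x i)
  lintegral_dist := by
    have hn' : (0 : ℝ) < n := Nat.cast_pos.2 hn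
    rw [gaussianVec, gaussianVec, lintegral_map_equiv]
    simp_rw [lintegral_map_equiv, tiltDensity_coordEquiv e hn hθ, distortion_coordEquiv]
    have h : ∀ᵐ v ∂(Measure.pi fun i => gaussianReal 0 (s i - θ)), ∀ i, _ := ae_all_iff.2 fun i =>
      (measurePreserving_eval (fun i => gaussianReal 0 (s i - θ)) i).quasiMeasurePreserving.ae
        (lintegral_exp_gaussianTilt_mul_eq hθ (hs i))
    have key : ∀ᵐ v ∂(Measure.pi fun i => gaussianReal 0 (s i - θ)),
        ∫⁻ x : Fin n → ℝ, (∏ i, ENNReal.ofReal (Real.exp (gaussianTilt θ (s i) (x i) (v i)))) *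
          ENNReal.ofReal (1 / (n : ℝ) * ∑ i, (x i - v i) ^ 2)
            ∂(Measure.pi fun i => gaussianReal 0 (s i))
          = ENNReal.ofReal (1 / n * ∑ i, min (θ : ℝ) (s i)) := by
      filter_upwards [h] with v hv
      have hmeas : ∀ i, Measurable fun x => ENNReal.ofReal
          (Real.exp (gaussianTilt θ (s i) x (v i))) := fun i =>
        (measurable_gaussianTilt_left θ (s i) (v i)).exp.ennreal_ofReal
      -- One coordinate carries the squared error and contributes `min(θ, sₖ)`; all other factors
      -- integrate to one.
      have hterm : ∀ k : Fin n,
          ∫⁻ x : Fin n → ℝ, (∏ i, ENNReal.ofReal (Real.exp (gaussianTilt θ (s i) (x i) (v i)))) *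
            ENNReal.ofReal ((x k - v k) ^ 2) ∂(Measure.pi fun i => gaussianReal 0 (s i))
          = ENNReal.ofReal (min (θ : ℝ) (s k)) := fun k => by
        have hprod : ∀ x : Fin n → ℝ,
            (∏ i, ENNReal.ofReal (Real.exp (gaussianTilt θ (s i) (x i) (v i)))) *
              ENNReal.ofReal ((x k - v k) ^ 2)
            = ∏ i, (ENNReal.ofReal (Real.exp (gaussianTilt θ (s i) (x i) (v i))) *
                if i = k then ENNReal.ofReal ((x i - v i) ^ 2) else 1) := fun x => by
          rw [Finset.prod_mul_distrib, Finset.prod_ite_eq']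
          simp
        simp_rw [hprod]
        rw [lintegral_pi_prod _ (fun i x => ENNReal.ofReal
          (Real.exp (gaussianTilt θ (s i) x (v i))) *
            if i = k then ENNReal.ofReal ((x - v i) ^ 2) else 1)]
        · rw [Finset.prod_eq_single k]
          · simpa using (hv k).2
          · intro i _ hik
            simpa [hik] using (hv i).1
          · simp
        · intro i
          refine (hmeas i).mul ?_
          split_ifs <;> fun_prop
      have hsum : ∀ x : Fin n → ℝ,
          (∏ i, ENNReal.ofReal (Real.exp (gaussianTilt θ (s i) (x i) (v i)))) *
            ENNReal.ofReal (1 / (n : ℝ) * ∑ i, (x i - v i) ^ 2)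
          = ENNReal.ofReal (1 / (n : ℝ)) * ∑ k,
            (∏ i, ENNReal.ofReal (Real.exp (gaussianTilt θ (s i) (x i) (v i)))) *
              ENNReal.ofReal ((x k - v k) ^ 2) := fun x => by
        rw [ENNReal.ofReal_mul (by positivity), ENNReal.ofReal_sum_of_nonneg
          fun i _ => sq_nonneg _, ← Finset.mul_sum]
        ring
      have hmp : Measurable fun x : Fin n → ℝ =>
          ∏ i, ENNReal.ofReal (Real.exp (gaussianTilt θ (s i) (x i) (v i))) :=
        Finset.measurable_prod _ fun i _ => (hmeas i).comp (measurable_pi_apply i)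
      have hmk : ∀ k, Measurable fun x : Fin n → ℝ =>
          (∏ i, ENNReal.ofReal (Real.exp (gaussianTilt θ (s i) (x i) (v i)))) *
            ENNReal.ofReal ((x k - v k) ^ 2) := fun k => hmp.mul (by fun_prop)
      simp_rw [hsum]
      rw [lintegral_const_mul _ (Finset.measurable_sum _ fun k _ => hmk k),
        lintegral_finsetSum _ fun k _ => hmk k]
      simp_rw [hterm]
      rw [ENNReal.ofReal_mul (by positivity), ENNReal.ofReal_sum_of_nonneg]
      intro i _
      positivity
    rw [lintegral_congr_ae key]
    simp

/-- Variances of independent summands add, and `Var[x²] = 2s²` turns the coefficient `min(θ,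
s)/(2θs)` into `(1/2)(min(θ, s)/θ)²`. -/
lemma evariance_waterfillTilt (hs : ∀ i, 0 < s i) {θ : ℝ} (hθ : 0 < θ) :
    evariance (waterfillTilt e s θ) (gaussianVec e s)
      = ENNReal.ofReal (1 / 2 * ∑ i, (min θ (s i) / θ) ^ 2) := by
  set m : Measure (Fin n → ℝ) := Measure.pi fun i => gaussianReal 0 (s i) with hm
  set f : Fin n → ℝ → ℝ := fun i x => min θ (s i) / (2 * θ * s i) * x ^ 2 with hf
  set c : ℝ := ∑ i, (1 / 2 * Real.log (max θ (s i) / θ) - min θ (s i) / (2 * θ)) with hc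
  have hfL : ∀ i, MemLp (f i) 2 (gaussianReal 0 (s i)) := fun i =>
    (memLp_sq_gaussianReal (s i)).const_mul _
  have hfL' : MemLp (∑ i, fun x : Fin n → ℝ => f i (x i)) 2 m :=
    memLp_finsetSum' _ fun i _ => (hfL i).comp_measurePreserving (measurePreserving_eval _ i)
  have heq : waterfillTilt e s θ ∘ coordEquiv e
      = fun x => (∑ i, fun x : Fin n → ℝ => f i (x i)) x + c := by
    ext x
    simp only [Function.comp, waterfillTilt_coordEquiv, hf, hc, Finset.sum_apply]
    rw [← Finset.sum_add_distrib]
    refine Finset.sum_congr rfl fun i _ => ?_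
    have hi : (s i : ℝ) ≠ 0 := NNReal.coe_ne_zero.2 (hs i).ne'
    field_simp
    ring
  have hL : MemLp (waterfillTilt e s θ) 2 (gaussianVec e s) := by
    rw [gaussianVec, (coordEquiv e).measurableEmbedding.memLp_map_measure_iff, heq]
    exact hfL'.add (memLp_const c)
  rw [← ENNReal.ofReal_toReal (evariance_ne_top hL)]
  congr 1
  change variance _ _ = _
  rw [gaussianVec, variance_map_equiv, heq]
  rw [variance_add_const hfL'.aestronglyMeasurable, variance_sum_pi hfL, Finset.mul_sum]
  refine Finset.sum_congr rfl fun i _ => ?_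
  have hi : (s i : ℝ) ≠ 0 := NNReal.coe_ne_zero.2 (hs i).ne'
  rw [hf, variance_const_mul, variance_sq_gaussianReal]
  field_simp

end GaussianVector

/-! ### Water levels: existence, uniqueness and stability. -/

section WaterLevel

/-- A concave nondecreasing function is strictly increasing below its supremum. -/
lemma ConcaveOn.lt_of_lt_of_monotone {G : ℝ → ℝ} (hG : ConcaveOn ℝ Set.univ G) (hmono : Monotone G)
    {t t' T : ℝ} (ht : t < t') (hT : G t < G T) : G t < G t' := by
  rcases le_or_gt T t' with h | h
  · exact hT.trans_le (hmono h)
  · have hpos : 0 < T - t := by linarith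
    have hb : 0 < (t' - t) / (T - t) := div_pos (by linarith) hpos
    have ha : 0 ≤ (T - t') / (T - t) := div_nonneg (by linarith) hpos.le
    have hab : (T - t') / (T - t) + (t' - t) / (T - t) = 1 := by field_simp; ring
    have := hG.2 (Set.mem_univ t) (Set.mem_univ T) ha hb.le hab
    have heq : ((T - t') / (T - t)) • t + ((t' - t) / (T - t)) • T = t' := by
      simp only [smul_eq_mul]; field_simp; ring
    rw [heq] at this
    simp only [smul_eq_mul] at this
    have h1 : (T - t') / (T - t) = 1 - (t' - t) / (T - t) := by linarith
    rw [h1] at this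
    nlinarith [mul_lt_mul_of_pos_left hT hb]

lemma existsUnique_level {G : ℝ → ℝ} (hG : ConcaveOn ℝ Set.univ G) (hmono : Monotone G)
    (hcont : Continuous G) (h0 : G 0 = 0) {d T : ℝ} (hd : 0 < d) (hT : d < G T) :
    ∃! θ, 0 < θ ∧ d = G θ := by
  have hT0 : 0 ≤ T := by
    by_contra! h
    have := hmono h.le
    linarith
  obtain ⟨θ, hθ, hθd⟩ := intermediate_value_Icc hT0 hcont.continuousOn
    (show d ∈ Set.Icc (G 0) (G T) from ⟨by linarith, hT.le⟩)
  refine ⟨θ, ⟨lt_of_le_of_ne hθ.1 ?_, hθd.symm⟩, ?_⟩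
  · rintro rfl
    linarith
  · rintro θ' ⟨-, hθ'⟩
    rcases lt_trichotomy θ' θ with h | h | h
    · have := hG.lt_of_lt_of_monotone hmono h (T := T) (by linarith)
      linarith
    · exact h
    · have := hG.lt_of_lt_of_monotone hmono h (T := T) (by linarith)
      linarith

/-- Levels of monotone functions converge when the functions do so pointwise. -/
lemma tendsto_level {α : Type*} {f : Filter α} {F : α → ℝ → ℝ} {G : ℝ → ℝ} {δ τ : α → ℝ}
    {d θ T : ℝ} (hG : ConcaveOn ℝ Set.univ G) (hmono : Monotone G) (hF : ∀ a, Monotone (F a))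
    (hFG : ∀ t, Tendsto (fun a => F a t) f (nhds (G t))) (hδ : Tendsto δ f (nhds d))
    (hτ : ∀ᶠ a in f, F a (τ a) = δ a) (hθ : G θ = d) (hT : d < G T) :
    Tendsto τ f (nhds θ) := by
  rw [tendsto_order]
  constructor
  -- Strictness below the supremum separates `G t` from `d`; pointwise convergence carries this to
  -- `F a t < F a (τ a)`, and monotonicity gives `t < τ a`. No uniform convergence is needed.
  · intro t ht
    have hlt : G t < d := by
      rw [← hθ]
      exact hG.lt_of_lt_of_monotone hmono ht (((hmono ht.le).trans_eq hθ).trans_lt hT)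
    filter_upwards [(hFG t).eventually_lt hδ hlt, hτ] with a h1 h2
    rw [← h2] at h1
    exact (hF a).reflect_lt h1
  · intro t ht
    have hlt : d < G t := by
      rw [← hθ]
      exact hG.lt_of_lt_of_monotone hmono ht (hθ.trans_lt hT)
    filter_upwards [hδ.eventually_lt (hFG t) hlt, hτ] with a h1 h2
    rw [← h2] at h1
    exact (hF a).reflect_lt h1

lemma concaveOn_min_const (c : ℝ) : ConcaveOn ℝ Set.univ fun t : ℝ => min t c :=
  (concaveOn_id convex_univ).inf (concaveOn_const c convex_univ)

/-- The distortion `(1/n) ∑ min(t, sᵢ)` of reverse waterfilling at level `t`. -/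
noncomputable def waterfill {n : ℕ} (s : Fin n → ℝ) (t : ℝ) : ℝ :=
  1 / (n : ℝ) * ∑ i, min t (s i)

variable {n : ℕ} {s : Fin n → ℝ}

lemma concaveOn_waterfill : ConcaveOn ℝ Set.univ (waterfill s) := by
  have h : ConcaveOn ℝ Set.univ fun t : ℝ => ∑ i, min t (s i) := by
    have : (fun t : ℝ => ∑ i, min t (s i)) = ∑ i, fun t => min t (s i) := by ext; simp
    rw [this]
    exact Finset.sum_induction _ (ConcaveOn ℝ Set.univ) (fun _ _ h1 h2 => h1.add h2)
      (concaveOn_const 0 convex_univ) fun i _ => concaveOn_min_const (s i)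
  exact h.smul (by positivity : (0 : ℝ) ≤ 1 / n)

lemma monotone_waterfill : Monotone (waterfill s) := fun t t' h => by
  unfold waterfill
  gcongr

lemma continuous_waterfill : Continuous (waterfill s) := by
  unfold waterfill
  fun_prop

lemma waterfill_zero (hs : ∀ i, 0 ≤ s i) : waterfill s 0 = 0 := by
  simp [waterfill, hs]

lemma exists_lt_waterfill {d : ℝ} (hd : d < 1 / (n : ℝ) * ∑ i, s i) :
    ∃ T, d < waterfill s T := by
  refine ⟨∑ i, |s i|, ?_⟩
  convert hd using 1
  rw [waterfill]
  congr 1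
  refine Finset.sum_congr rfl fun i _ => min_eq_right ?_
  exact (le_abs_self _).trans (Finset.single_le_sum (f := fun i => |s i|)
    (fun i _ => abs_nonneg _) (Finset.mem_univ i))

lemma waterfill_le (t : ℝ) : waterfill s t ≤ 1 / (n : ℝ) * ∑ i, s i := by
  unfold waterfill
  gcongr
  exact min_le_right _ _

lemma existsUnique_isWaterLevel (hs : ∀ i, 0 ≤ s i) {d : ℝ} (hd0 : 0 < d)
    (hd : d < 1 / (n : ℝ) * ∑ i, s i) : ∃! θ, IsWaterLevel s d θ := by
  obtain ⟨T, hT⟩ := exists_lt_waterfill hd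
  exact existsUnique_level concaveOn_waterfill monotone_waterfill continuous_waterfill
    (waterfill_zero hs) hd0 hT

end WaterLevel

/-! ### Slope, minimizers and tilted information for Gaussian vectors. -/

section GaussianRateDistortion

variable {n : ℕ} {s : Fin n → ℝ≥0}
  (e : EuclideanSpace ℝ (Fin n) ≃ₗᵢ[ℝ] EuclideanSpace ℝ (Fin n))

lemma IsWaterLevel.isTiltCertificate (hn : 0 < n) (hs : ∀ i, 0 < s i) {d θ : ℝ}
    (h : IsWaterLevel (fun i => (s i : ℝ)) d θ) :
    IsTiltCertificate (gaussianVec e s) d (n / (2 * θ)) (waterfillTilt e s θ)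
      (gaussianVec e fun i => s i - θ.toNNReal) := by
  obtain ⟨h0, rfl⟩ := h
  have := isTiltCertificate_gaussianVec e hn hs (Real.toNNReal_pos.2 h0)
  rwa [Real.coe_toNNReal _ h0.le] at this

/-- The slope of the rate-distortion function of a Gaussian vector. -/
lemma hasDerivAt_rdf_gaussianVec (hn : 0 < n) (hs : ∀ i, 0 < s i) {d θ : ℝ} (hd0 : 0 < d)
    (hd : d < 1 / (n : ℝ) * ∑ i, (s i : ℝ)) (hθ : IsWaterLevel (fun i => (s i : ℝ)) d θ) :
    HasDerivAt (rdf (gaussianVec e s)) (-(1 / (2 * θ))) d := by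
  have hex : ∀ t ∈ Set.Ioo 0 (1 / (n : ℝ) * ∑ i, (s i : ℝ)),
      ∃ τ, IsWaterLevel (fun i => (s i : ℝ)) t τ := fun t ht =>
    (existsUnique_isWaterLevel (fun i => (s i).2) ht.1 ht.2).exists
  choose! τ hτ using hex
  have hI : Set.Ioo 0 (1 / (n : ℝ) * ∑ i, (s i : ℝ)) ∈ nhds d := Ioo_mem_nhds hd0 hd
  have hτd : τ d = θ :=
    (existsUnique_isWaterLevel (fun i => (s i).2) hd0 hd).unique (hτ d ⟨hd0, hd⟩) hθ
  obtain ⟨T, hT⟩ := exists_lt_waterfill hd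
  -- Continuity of the level in the distortion: `tendsto_level` with a fixed curve and a moving
  -- target.
  have hcont : Tendsto τ (nhds d) (nhds θ) :=
    tendsto_level (F := fun _ => waterfill fun i => (s i : ℝ)) concaveOn_waterfill
      monotone_waterfill (fun _ => monotone_waterfill) (fun t => tendsto_const_nhds) tendsto_id
      (by filter_upwards [hI] with t ht using (hτ t ht).2.symm) hθ.2.symm hT
  have hl : ContinuousAt (fun t => (n : ℝ) / (2 * τ t)) d := by
    have h2 : (2 : ℝ) * θ ≠ 0 := by have := hθ.1; positivity
    rw [← hτd] at hcont h2
    exact tendsto_const_nhds.div (hcont.const_mul 2) h2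
  have := hasDerivAt_rdf hI _ hl (fun t => waterfillTilt e s (τ t))
    (fun t => gaussianVec e fun i => s i - (τ t).toNNReal) (fun t _ => inferInstance)
    (fun t ht => (hτ t ht).isTiltCertificate e hn hs)
    (fun t ht => integral_waterfillTilt_nonneg e hs (hτ t ht).1)
  have hn' : (n : ℝ) ≠ 0 := Nat.cast_ne_zero.2 hn.ne'
  rw [hτd] at this
  convert this using 2
  field_simp

lemma exists_isRDFAchieving_gaussianVec (hn : 0 < n) (hs : ∀ i, 0 < s i) {d : ℝ} (hd0 : 0 < d)
    (hd : d < 1 / (n : ℝ) * ∑ i, (s i : ℝ)) : ∃ κ, IsRDFAchieving (gaussianVec e s) d κ := by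
  obtain ⟨θ, hθ, -⟩ := existsUnique_isWaterLevel (fun i => (s i).2) hd0 hd
  exact (hθ.isTiltCertificate e hn hs).exists_isRDFAchieving

/-- The normalized slope is `1/(2θ)`, so the factor `n` in `tiltedInfo` restores the certificate's
slope `n/(2θ)`, and any minimizer may be used. -/
lemma tiltedInfo_gaussianVec (hn : 0 < n) (hs : ∀ i, 0 < s i) {d θ : ℝ} (hd0 : 0 < d)
    (hd : d < 1 / (n : ℝ) * ∑ i, (s i : ℝ)) (hθ : IsWaterLevel (fun i => (s i : ℝ)) d θ)
    {κ : Kernel (EuclideanSpace ℝ (Fin n)) (EuclideanSpace ℝ (Fin n))}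
    (hκ : IsRDFAchieving (gaussianVec e s) d κ) (u : EuclideanSpace ℝ (Fin n)) :
    tiltedInfo (gaussianVec e s) d κ u = waterfillTilt e s θ u := by
  have := isOpenPosMeasure_gaussianVec e s hs
  have hslope : negSlope (gaussianVec e s) d = 1 / (2 * θ) := by
    rw [negSlope, (hasDerivAt_rdf_gaussianVec e hn hs hd0 hd hθ).deriv, neg_neg]
  rw [← (hθ.isTiltCertificate e hn hs).eq_of_isRDFAchieving
    (integral_waterfillTilt_nonneg e hs hθ.1) hκ u, tiltedInfo, hslope]
  have h1 : -(1 / (2 * θ)) * (n : ℝ) = -(n / (2 * θ)) := by ring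
  rw [h1]

end GaussianRateDistortion

/-- At distortions above the mean energy, a constant output is optimal. -/
lemma exists_isRDFAchieving_of_le {n : ℕ} (μ : Measure (EuclideanSpace ℝ (Fin n)))
    [IsProbabilityMeasure μ] {d : ℝ}
    (hd : ∫⁻ u, ENNReal.ofReal (distortion u 0) ∂μ ≤ ENNReal.ofReal d) :
    ∃ κ, IsRDFAchieving μ d κ := by
  have h1 : expectedDistortion μ (Kernel.const _ (Measure.dirac 0)) ≤ ENNReal.ofReal d := by
    simpa [expectedDistortion] using hd
  have h2 : mutualInfo μ (Kernel.const (EuclideanSpace ℝ (Fin n))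
      (Measure.dirac (0 : EuclideanSpace ℝ (Fin n)))) = 0 := by
    have hb : μ.bind (Kernel.const (EuclideanSpace ℝ (Fin n))
        (Measure.dirac (0 : EuclideanSpace ℝ (Fin n)))) = Measure.dirac 0 := by
      rw [Measure.const_comp]; simp
    rw [mutualInfo, hb, Measure.compProd_const, InformationTheory.klDiv_self]
  refine ⟨Kernel.const _ (Measure.dirac 0), inferInstance, h1, ?_⟩
  rw [h2, eq_comm, ← nonpos_iff_eq_zero, ← h2]
  exact iInf_le_of_le _ (iInf_le_of_le inferInstance (iInf_le _ h1))

/-! ### The bidiagonal whitening matrix and the precision matrix. -/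

section Whitening

/-- The matrix that maps the source vector to the innovations. -/
def whiten (a : ℝ) (n : ℕ) : Matrix (Fin n) (Fin n) ℝ :=
  Matrix.of fun i k => (if k = i then 1 else 0) + (if (k : ℕ) + 1 = i then -a else 0)

variable {n : ℕ}

lemma sum_whiten_row (a : ℝ) {i j : Fin n} (h : (j : ℕ) + 1 = i) (f : Fin n → ℝ) :
    ∑ k, whiten a n i k * f k = f i - a * f j := by
  have h1 : ∀ k : Fin n, ((k : ℕ) + 1 = i) ↔ k = j := fun k => by
    rw [Fin.ext_iff]; omega
  simp [whiten, h1, add_mul, Finset.sum_add_distrib, sub_eq_add_neg]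

lemma sum_whiten_row_zero (a : ℝ) {i : Fin n} (h : (i : ℕ) = 0) (f : Fin n → ℝ) :
    ∑ k, whiten a n i k * f k = f i := by
  simp [whiten, h]

lemma sum_whiten_col (a : ℝ) {i j : Fin n} (h : (i : ℕ) + 1 = j) (f : Fin n → ℝ) :
    ∑ k, whiten a n k i * f k = f i - a * f j := by
  have h1 : ∀ k : Fin n, ((i : ℕ) + 1 = k) ↔ k = j := fun k => by
    rw [Fin.ext_iff]; omega
  simp [whiten, h1, add_mul, Finset.sum_add_distrib, sub_eq_add_neg, eq_comm (a := i)]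

lemma sum_whiten_nat (a : ℝ) (i : Fin n) (f : ℕ → ℝ) (h0 : f 0 = 0) :
    ∑ k, whiten a n i k * f (k + 1) = f (i + 1) - a * f i := by
  rcases Nat.eq_zero_or_pos (i : ℕ) with hi | hi
  · rw [sum_whiten_row_zero a hi fun k : Fin n => f (k + 1), hi, h0]
    simp
  · have hj : ((⟨i - 1, by omega⟩ : Fin n) : ℕ) + 1 = i := by simp; omega
    rw [sum_whiten_row a hj fun k : Fin n => f (k + 1), hj]

/-- The whitening matrix has operator norm at most `2`. -/
lemma sum_whiten_mulVec_sq_le {a : ℝ} (ha0 : 0 ≤ a) (ha1 : a < 1) (y : Fin n → ℝ) :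
    ∑ i, (∑ k, whiten a n i k * y k) ^ 2 ≤ 4 * ∑ i, y i ^ 2 := by
  -- Shifting the index by one and padding with zeros gives every row the form `f (i + 1) - a * f
  -- i`, including the first.
  set f : ℕ → ℝ := fun m => if h : 1 ≤ m ∧ m ≤ n then y ⟨m - 1, by omega⟩ else 0 with hf
  have hfy : ∀ k : Fin n, f (k + 1) = y k := fun k => by simp [hf]
  have hf0 : f 0 = 0 := by simp [hf]
  have h1 : ∀ i, (∑ k, whiten a n i k * y k) ^ 2 ≤ 2 * f (i + 1) ^ 2 + 2 * f i ^ 2 := fun i => by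
    have : ∑ k, whiten a n i k * y k = f (i + 1) - a * f i := by
      rw [← sum_whiten_nat a i f hf0]
      simp_rw [hfy]
    rw [this]
    have h2 : 0 ≤ (1 - a ^ 2) * f i ^ 2 := mul_nonneg (by nlinarith) (sq_nonneg _)
    nlinarith [sq_nonneg (f (i + 1) + a * f i)]
  have h2 : ∑ i : Fin n, f i ^ 2 ≤ ∑ i : Fin n, f (i + 1) ^ 2 := by
    rw [Fin.sum_univ_eq_sum_range fun m => f m ^ 2,
      Fin.sum_univ_eq_sum_range fun m => f (m + 1) ^ 2]
    have h3 := Finset.sum_range_succ' (fun m => f m ^ 2) n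
    have h4 := Finset.sum_range_succ (fun m => f m ^ 2) n
    simp only [hf0] at h3
    nlinarith [sq_nonneg (f n)]
  have h3 : ∑ i : Fin n, f (i + 1) ^ 2 = ∑ i, y i ^ 2 := by simp_rw [hfy]
  calc _ ≤ ∑ i : Fin n, (2 * f (i + 1) ^ 2 + 2 * f i ^ 2) := Finset.sum_le_sum fun i _ => h1 i
    _ = 2 * ∑ i : Fin n, f (i + 1) ^ 2 + 2 * ∑ i : Fin n, f i ^ 2 := by
      rw [Finset.sum_add_distrib, Finset.mul_sum, Finset.mul_sum]
    _ ≤ _ := by linarith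

/-- If `B Σ Bᵀ = c` and `Σ = S diag(s) Sᵀ`, then `S` diagonalizes the precision matrix `Bᵀ B`
as well. -/
lemma diagonalize_precision {B S : Matrix (Fin n) (Fin n) ℝ} {s : Fin n → ℝ} {c : ℝ} (hc : 0 < c)
    (h : B * (S * Matrix.diagonal s * S.transpose) * B.transpose = c • 1) :
    (∀ i, 0 < s i) ∧
      S.transpose * (B.transpose * B) * S = Matrix.diagonal fun i => c / s i := by
  set C := B * S with hC
  have h1 : (c⁻¹ • (C * Matrix.diagonal s)) * C.transpose = 1 := by
    have : C * Matrix.diagonal s * C.transpose = c • 1 := by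
      rw [← h, hC, Matrix.transpose_mul]; simp only [Matrix.mul_assoc]
    rw [Matrix.smul_mul, this, smul_smul, inv_mul_cancel₀ hc.ne', one_smul]
  -- A right inverse of a square matrix is a left inverse, which allows `Cᵀ` to be moved to the
  -- front.
  have h2 : C.transpose * C * Matrix.diagonal s = c • 1 := by
    have := mul_eq_one_comm.1 h1
    rw [Matrix.mul_smul, ← Matrix.mul_assoc] at this
    rw [← this, smul_smul, mul_inv_cancel₀ hc.ne', one_smul]
  have h3 : ∀ i j, (C.transpose * C) i j * s j = if i = j then c else 0 := fun i j => by
    have := congrFun (congrFun h2 i) j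
    rw [Matrix.mul_diagonal] at this
    rw [this, Matrix.smul_apply, Matrix.one_apply]
    simp
  -- Positivity comes for free: the product of `sᵢ` with a nonnegative diagonal entry of `CᵀC` is `c
  -- > 0`.
  have hpos : ∀ i, 0 < s i := fun i => by
    have h4 := h3 i i
    have h5 : 0 ≤ (C.transpose * C) i i := by
      rw [Matrix.mul_apply]
      exact Finset.sum_nonneg fun k _ => by
        rw [Matrix.transpose_apply]; exact mul_self_nonneg _
    rw [if_pos rfl] at h4
    exact pos_of_mul_pos_right (h4 ▸ hc) h5
  refine ⟨hpos, ?_⟩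
  have h6 : S.transpose * (B.transpose * B) * S = C.transpose * C := by
    rw [hC, Matrix.transpose_mul]; simp only [Matrix.mul_assoc]
  rw [h6]
  ext i j
  rw [Matrix.diagonal_apply, eq_div_of_mul_eq (hpos j).ne' (h3 i j)]
  split_ifs with hij
  · rw [hij]
  · simp

end Whitening

/-! ### Orthogonal matrices as isometries. -/

section OrthogonalEquiv

variable {n : ℕ}

/-- The isometry `x ↦ S x` of an orthogonal matrix; its inverse is `decorrelate S`. -/
noncomputable def orthogonalEquiv (S : Matrix (Fin n) (Fin n) ℝ)
    (hS : S ∈ Matrix.orthogonalGroup (Fin n) ℝ) :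
    EuclideanSpace ℝ (Fin n) ≃ₗᵢ[ℝ] EuclideanSpace ℝ (Fin n) :=
  LinearIsometryEquiv.symm
    { toFun := decorrelate S
      invFun := fun x => WithLp.toLp 2 (S.mulVec (WithLp.ofLp x))
      map_add' := fun x y => by simp [decorrelate, Matrix.mulVec_add]
      map_smul' := fun c x => by simp [decorrelate, Matrix.mulVec_smul]
      left_inv := fun x => by
        have := (Matrix.mem_orthogonalGroup_iff _ _).1 hS
        simp [decorrelate, this]
      right_inv := fun x => by
        have := (Matrix.mem_orthogonalGroup_iff' _ _).1 hS
        simp [decorrelate, this]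
      norm_map' := fun x => by
        have := (Matrix.mem_orthogonalGroup_iff _ _).1 hS
        change ‖decorrelate S x‖ = ‖x‖
        rw [← sq_eq_sq₀ (norm_nonneg _) (norm_nonneg _), EuclideanSpace.real_norm_sq_eq,
          EuclideanSpace.real_norm_sq_eq]
        have h : ∀ y : Fin n → ℝ, ∑ i, y i ^ 2 = y ⬝ᵥ y := fun y => by simp [dotProduct, sq]
        rw [h, h]
        change S.transpose.mulVec (WithLp.ofLp x) ⬝ᵥ S.transpose.mulVec (WithLp.ofLp x) = _
        rw [Matrix.dotProduct_mulVec, Matrix.vecMul_transpose, Matrix.mulVec_mulVec, this,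
          Matrix.one_mulVec] }

end OrthogonalEquiv

lemma integral_sum_mul_sum {Ω ι : Type*} [MeasurableSpace Ω] [Fintype ι] {P : Measure Ω}
    {V : ι → Ω → ℝ} (hI : ∀ k l, Integrable (fun ω => V k ω * V l ω) P) (A B : ι → ℝ) :
    ∫ ω, (∑ k, A k * V k ω) * (∑ l, B l * V l ω) ∂P
      = ∑ k, ∑ l, A k * B l * ∫ ω, V k ω * V l ω ∂P := by
  have h : ∀ ω, (∑ k, A k * V k ω) * (∑ l, B l * V l ω)
      = ∑ k, ∑ l, A k * B l * (V k ω * V l ω) := fun ω => by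
    rw [Finset.sum_mul_sum]
    refine Finset.sum_congr rfl fun k _ => Finset.sum_congr rfl fun l _ => by ring
  simp_rw [h]
  rw [integral_finsetSum _ fun k _ => integrable_finsetSum _ fun l _ => (hI k l).const_mul _]
  refine Finset.sum_congr rfl fun k _ => ?_
  rw [integral_finsetSum _ fun l _ => (hI k l).const_mul _]
  simp_rw [integral_const_mul]

/-! ### Laws of the source vector and of its decorrelation. -/

namespace IsGaussMarkov

variable {Ω : Type*} [MeasurableSpace Ω] {P : Measure Ω} {a : ℝ}
  {σ : ℝ≥0} {U : ℕ → Ω → ℝ}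

lemma measurable (hU : IsGaussMarkov P a σ U) (i : ℕ) : Measurable (U i) := by
  obtain ⟨Z, hZ, -, -, h0, h⟩ := hU
  induction i with
  | zero => exact (by simp [funext h0] : U 0 = fun _ => 0) ▸ measurable_const
  | succ i ih =>
    rw [funext (h i)]
    exact (ih.const_mul a).add (hZ i)

lemma measurable_sourceVec (hU : IsGaussMarkov P a σ U) (n : ℕ) : Measurable (sourceVec U n) :=
  (WithLp.measurable_toLp 2 _).comp (measurable_pi_lambda _ fun i => hU.measurable (i + 1))

/-- Unrolling the recursion, `U (i + 1) = ∑ a^(i - k) Z k` over `k ≤ i`, so the vector is a linear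
image of independent centered Gaussians. -/
lemma hasGaussianLaw (hU : IsGaussMarkov P a σ U) (n : ℕ) :
    HasGaussianLaw (fun ω (i : Fin n) => U (i + 1) ω) P ∧ ∀ i, ∫ ω, U i ω ∂P = 0 := by
  obtain ⟨Z, hZ, hlaw, hind, h0, h⟩ := hU
  have hrep : ∀ i ω, U (i + 1) ω = ∑ k ∈ Finset.range (i + 1), a ^ (i - k) * Z k ω := by
    intro i ω
    induction i with
    | zero => simp [h, h0]
    | succ i ih =>
      rw [h, ih, Finset.sum_range_succ _ (i + 1), Finset.mul_sum]
      simp only [tsub_self, pow_zero, one_mul]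
      congr 1
      refine Finset.sum_congr rfl fun k hk => ?_
      have hk' : k ≤ i := by simpa [Nat.lt_succ_iff] using hk
      rw [Nat.succ_sub hk', pow_succ]
      ring
  have hZG : ∀ i, HasGaussianLaw (Z i) P := fun i =>
    (⟨(hZ i).aemeasurable, hlaw i⟩ : HasLaw (Z i) (gaussianReal 0 (σ ^ 2)) P).hasGaussianLaw
  have hZm : ∀ i, ∫ ω, Z i ω ∂P = 0 := fun i => by
    rw [← integral_id_gaussianReal (μ := 0) (v := σ ^ 2), ← hlaw i,
      integral_map (hZ i).aemeasurable (by fun_prop)]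
  refine ⟨?_, fun i => ?_⟩
  · have hZn : HasGaussianLaw (fun ω (i : Fin n) => Z i ω) P :=
      iIndepFun.hasGaussianLaw (fun i : Fin n => hZG i) (hind.precomp Fin.val_injective)
    have hL := hZn.map_fun (LinearMap.toContinuousLinearMap (Matrix.mulVecLin
      (Matrix.of fun i k : Fin n => if (k : ℕ) ≤ i then a ^ ((i : ℕ) - k) else 0)))
    refine (congrArg (HasGaussianLaw · P) (funext fun ω => funext fun i => ?_)).mpr hL
    rw [hrep]
    simp only [LinearMap.coe_toContinuousLinearMap', Matrix.mulVecLin_apply, Matrix.mulVec,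
      dotProduct, Matrix.of_apply]
    rw [Fin.sum_univ_eq_sum_range fun k => (if k ≤ (i : ℕ) then a ^ ((i : ℕ) - k) else 0) * Z k ω]
    simp only [ite_mul, zero_mul]
    rw [← Finset.sum_filter]
    refine Finset.sum_congr ?_ fun _ _ => rfl
    ext k
    simp only [Finset.mem_range, Finset.mem_filter]
    omega
  · cases i with
    | zero => simp [h0]
    | succ i =>
      simp_rw [hrep]
      rw [integral_finsetSum _ fun k _ => (hZG k).integrable.const_mul _]
      simp [integral_const_mul, hZm]

lemma memLp (hU : IsGaussMarkov P a σ U) (i : ℕ) : MemLp (U (i + 1)) 2 P :=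
  ((hU.hasGaussianLaw (i + 1)).1.eval (Fin.last i)).memLp_two

/-- Whitening the source vector gives the innovations. -/
lemma whiten_covMatrix (hU : IsGaussMarkov P a σ U) (n : ℕ) :
    whiten a n * covMatrix P U n * (whiten a n).transpose = ((σ : ℝ) ^ 2) • 1 := by
  have hL := hU.memLp
  obtain ⟨Z, hZ, hlaw, hind, h0, h⟩ := hU
  ext i j
  have hI : ∀ k l : Fin n, Integrable (fun ω => U (k + 1) ω * U (l + 1) ω) P := fun k l =>
    (hL k).integrable_mul (hL l)
  have hw : ∀ (i : Fin n) ω, ∑ k, whiten a n i k * U (k + 1) ω = Z i ω := fun i ω => by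
    rw [sum_whiten_nat a i (fun m => U m ω) (h0 ω), h]; ring
  have h1 : (whiten a n * covMatrix P U n * (whiten a n).transpose) i j
      = ∫ ω, Z i ω * Z j ω ∂P := by
    simp_rw [← hw]
    rw [integral_sum_mul_sum hI, Matrix.mul_assoc, Matrix.mul_apply]
    refine Finset.sum_congr rfl fun k _ => ?_
    rw [Matrix.mul_apply, Finset.mul_sum]
    refine Finset.sum_congr rfl fun l _ => ?_
    rw [covMatrix, Matrix.of_apply, Matrix.transpose_apply]
    ring
  rw [h1, Matrix.smul_apply, Matrix.one_apply]
  split_ifs with hij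
  · subst hij
    have h2 := integral_sq_gaussianReal_zero (σ ^ 2)
    rw [← hlaw i, integral_map (hZ i).aemeasurable (by fun_prop)] at h2
    simpa [sq] using h2
  · have hij' : (i : ℕ) ≠ j := fun hne => hij (Fin.ext hne)
    have hm : ∀ i, ∫ ω, Z i ω ∂P = 0 := fun i => by
      rw [← integral_id_gaussianReal (μ := 0) (v := σ ^ 2), ← hlaw i,
        integral_map (hZ i).aemeasurable (by fun_prop)]
    have := (hind.indepFun hij').integral_fun_mul_eq_mul_integral (hZ i).aestronglyMeasurable
      (hZ j).aestronglyMeasurable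
    rw [this, hm]
    simp

variable [IsProbabilityMeasure P] {n : ℕ} {S : Matrix (Fin n) (Fin n) ℝ} {s : Fin n → ℝ≥0}

/-- The law of the decorrelated source vector. -/
lemma map_decorrelate (hU : IsGaussMarkov P a σ U) (hS : S ∈ Matrix.orthogonalGroup (Fin n) ℝ)
    (hcov : covMatrix P U n = S * Matrix.diagonal (fun i => (s i : ℝ)) * S.transpose) :
    P.map (fun ω => decorrelate S (sourceVec U n ω))
      = gaussianVec (LinearIsometryEquiv.refl ℝ _) s := by
  obtain ⟨hG, hmean⟩ := hU.hasGaussianLaw n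
  have hL := hU.memLp
  set X : Fin n → Ω → ℝ := fun i ω => ∑ k, S k i * U (k + 1) ω with hX
  have hXG : HasGaussianLaw (fun ω => (X · ω)) P := by
    have := hG.map_fun (LinearMap.toContinuousLinearMap (Matrix.mulVecLin S.transpose))
    refine (congrArg (HasGaussianLaw · P) (funext fun ω => funext fun i => ?_)).mpr this
    simp [hX, Matrix.vecMul, dotProduct, mul_comm]
  have hXm : ∀ i, ∫ ω, X i ω ∂P = 0 := fun i => by
    simp only [hX]
    have h2 : ∀ k : Fin n, Integrable (fun ω => S k i * U (k + 1) ω) P := fun k =>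
      ((hL k).integrable (by norm_num)).const_mul _
    rw [integral_finsetSum _ fun k _ => h2 k]
    simp [integral_const_mul, hmean]
  have hXX : ∀ i j, ∫ ω, X i ω * X j ω ∂P = if i = j then (s i : ℝ) else 0 := fun i j => by
    have hI : ∀ k l : Fin n, Integrable (fun ω => U (k + 1) ω * U (l + 1) ω) P := fun k l =>
      (hL k).integrable_mul (hL l)
    have h1 : S.transpose * covMatrix P U n * S = Matrix.diagonal fun i => (s i : ℝ) := by
      have := (Matrix.mem_orthogonalGroup_iff' _ _).1 hS
      rw [hcov]
      calc _ = S.transpose * S * Matrix.diagonal (fun i => (s i : ℝ)) * (S.transpose * S) := by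
            simp only [Matrix.mul_assoc]
        _ = _ := by rw [this, one_mul, mul_one]
    rw [← Matrix.diagonal_apply (fun i => (s i : ℝ)), ← h1]
    simp only [hX]
    rw [integral_sum_mul_sum hI, Matrix.mul_assoc, Matrix.mul_apply]
    refine Finset.sum_congr rfl fun k _ => ?_
    rw [Matrix.mul_apply, Finset.mul_sum]
    refine Finset.sum_congr rfl fun l _ => ?_
    rw [covMatrix, Matrix.of_apply, Matrix.transpose_apply]
    ring
  have hXL : ∀ i, MemLp (X i) 2 P := fun i => (hXG.eval i).memLp_two
  -- Jointly Gaussian and uncorrelated components are independent.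
  have hind : iIndepFun X P := hXG.iIndepFun_of_covariance_eq_zero fun i j hij => by
    rw [covariance_eq_sub (hXL i) (hXL j)]
    simp [hXX, hXm, hij]
  have hlaw : ∀ i, P.map (X i) = gaussianReal 0 (s i) := fun i => by
    rw [(hXG.eval i).map_eq_gaussianReal, hXm, variance_eq_sub (hXL i)]
    have : ∫ ω, (X i ^ 2) ω ∂P = s i := by
      have := hXX i i
      simpa [sq] using this
    rw [this, hXm]
    simp
  have hpi := (iIndepFun_iff_map_fun_eq_pi_map fun i => (hXG.eval i).aemeasurable).1 hind
  simp_rw [hlaw] at hpi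
  rw [gaussianVec, ← hpi, AEMeasurable.map_map_of_aemeasurable
    (coordEquiv _).measurable.aemeasurable hXG.aemeasurable]
  congr 1

lemma map_sourceVec (hU : IsGaussMarkov P a σ U) (hS : S ∈ Matrix.orthogonalGroup (Fin n) ℝ)
    (hcov : covMatrix P U n = S * Matrix.diagonal (fun i => (s i : ℝ)) * S.transpose) :
    P.map (sourceVec U n) = gaussianVec (orthogonalEquiv S hS) s := by
  have h := congrArg (Measure.map (orthogonalEquiv S hS)) (hU.map_decorrelate hS hcov)
  have hm : Measurable (orthogonalEquiv S hS) := (orthogonalEquiv S hS).continuous.measurable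
  have hm' : Measurable fun ω => decorrelate S (sourceVec U n ω) :=
    (orthogonalEquiv S hS).symm.continuous.measurable.comp (hU.measurable_sourceVec n)
  rw [Measure.map_map hm hm', gaussianVec, Measure.map_map hm (coordEquiv _).measurable] at h
  refine Eq.trans ?_ h
  congr 1
  ext1 ω
  exact ((orthogonalEquiv S hS).apply_symm_apply (sourceVec U n ω)).symm

end IsGaussMarkov

/-! ### Limiting eigenvalue distribution by the moment method. -/

section Szego

/-- The symbol `1 + a² - 2 a cos w` of the precision matrix. -/
noncomputable def precisionSymbol (a w : ℝ) : ℝ := 1 + a ^ 2 - 2 * a * Real.cos w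

@[fun_prop]
lemma continuous_precisionSymbol (a : ℝ) : Continuous (precisionSymbol a) := by
  unfold precisionSymbol; fun_prop

lemma precisionSymbol_bounds {a : ℝ} (ha0 : 0 ≤ a) (ha1 : a < 1) (w : ℝ) :
    (1 - a) ^ 2 ≤ precisionSymbol a w ∧ precisionSymbol a w ≤ 4 := by
  unfold precisionSymbol
  constructor <;> nlinarith [Real.cos_le_one w, Real.neg_one_le_cos w]

/-- The Fourier coefficients of the powers of the symbol. -/
noncomputable def symbolCoeff (a : ℝ) (k : ℕ) (m : ℤ) : ℝ :=
  1 / (2 * Real.pi) * ∫ w in (-Real.pi)..Real.pi, precisionSymbol a w ^ k * Real.cos (m * w)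

lemma symbolCoeff_zero (a : ℝ) (m : ℤ) : symbolCoeff a 0 m = if m = 0 then 1 else 0 := by
  unfold symbolCoeff
  simp only [pow_zero, one_mul]
  split_ifs with h
  · subst h
    have := Real.pi_pos
    simp
    field_simp
    ring
  · have hm : (m : ℝ) ≠ 0 := Int.cast_ne_zero.2 h
    rw [intervalIntegral.integral_comp_mul_left Real.cos hm, integral_cos]
    simp [Real.sin_int_mul_pi]

/-- The product formula for cosines gives the three-term recursion that an interior row of the
tridiagonal matrix `BᵀB` also obeys. -/
lemma symbolCoeff_succ (a : ℝ) (k : ℕ) (m : ℤ) :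
    symbolCoeff a (k + 1) m = (1 + a ^ 2) * symbolCoeff a k m - a * symbolCoeff a k (m - 1)
      - a * symbolCoeff a k (m + 1) := by
  have hi : ∀ m : ℤ, IntervalIntegrable (fun w => precisionSymbol a w ^ k * Real.cos (m * w))
      volume (-Real.pi) Real.pi := fun m => Continuous.intervalIntegrable (by fun_prop) _ _
  have h : ∀ w, precisionSymbol a w ^ (k + 1) * Real.cos (m * w)
      = (1 + a ^ 2) * (precisionSymbol a w ^ k * Real.cos (m * w))
        - a * (precisionSymbol a w ^ k * Real.cos ((m - 1 : ℤ) * w))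
        - a * (precisionSymbol a w ^ k * Real.cos ((m + 1 : ℤ) * w)) := fun w => by
    have h1 : Real.cos ((m - 1 : ℤ) * w) + Real.cos ((m + 1 : ℤ) * w)
        = 2 * Real.cos w * Real.cos (m * w) := by
      push_cast
      rw [sub_mul, add_mul, one_mul, Real.cos_sub, Real.cos_add]
      ring
    have h2 : Real.cos ((m - 1 : ℤ) * w)
        = 2 * Real.cos w * Real.cos (m * w) - Real.cos ((m + 1 : ℤ) * w) := by linarith
    rw [h2, pow_succ]
    nth_rewrite 2 [precisionSymbol]
    ring
  unfold symbolCoeff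
  simp_rw [h]
  rw [intervalIntegral.integral_sub (((hi m).const_mul _).sub ((hi (m - 1)).const_mul _))
    ((hi (m + 1)).const_mul _), intervalIntegral.integral_sub ((hi m).const_mul _)
    ((hi (m - 1)).const_mul _), intervalIntegral.integral_const_mul,
    intervalIntegral.integral_const_mul, intervalIntegral.integral_const_mul]
  ring

variable {n : ℕ}

/-- Away from the corners, the powers of the precision matrix are Toeplitz. -/
lemma precision_pow_apply (a : ℝ) (k : ℕ) (i j : Fin n) (hi : k ≤ i) (hi' : (i : ℕ) + k < n) :
    (((whiten a n).transpose * whiten a n) ^ k) i j = symbolCoeff a k ((i : ℤ) - j) := by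
  induction k generalizing i with
  | zero =>
    rw [pow_zero, Matrix.one_apply, symbolCoeff_zero]
    have : ((i : ℤ) - j = 0) ↔ i = j := by rw [Fin.ext_iff]; omega
    simp [this]
  | succ k ih =>
    set M := ((whiten a n).transpose * whiten a n) ^ k with hM
    obtain ⟨p, hp⟩ : ∃ p : Fin n, (p : ℕ) + 1 = i := ⟨⟨i - 1, by omega⟩, by simp; omega⟩
    obtain ⟨q, hq⟩ : ∃ q : Fin n, (i : ℕ) + 1 = q := ⟨⟨i + 1, by omega⟩, rfl⟩
    -- Multiplying by `BᵀB` on the left mixes rows `i - 1`, `i` and `i + 1` only, so each power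
    -- costs one row at either end while the column `j` stays unrestricted.
    have h1 : (((whiten a n).transpose * whiten a n) ^ (k + 1)) i j
        = (M i j - a * M p j) - a * (M q j - a * M i j) := by
      rw [pow_succ', Matrix.mul_assoc, Matrix.mul_apply]
      simp only [Matrix.transpose_apply]
      rw [sum_whiten_col a hq fun k => (whiten a n * M) k j, Matrix.mul_apply, Matrix.mul_apply,
        sum_whiten_row a hp fun k => M k j, sum_whiten_row a hq fun k => M k j]
    rw [h1, ih i (by omega) (by omega), ih p (by omega) (by omega), ih q (by omega) (by omega),
      symbolCoeff_succ, show (p : ℤ) - j = (i : ℤ) - j - 1 by omega,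
      show (q : ℤ) - j = (i : ℤ) - j + 1 by omega]
    ring

/-- An orthogonal diagonalization of the precision matrix with eigenvalues `μ`. -/
structure IsPrecisionSpectrum (a : ℝ) (S : Matrix (Fin n) (Fin n) ℝ) (μ : Fin n → ℝ) : Prop where
  orthogonal : S ∈ Matrix.orthogonalGroup (Fin n) ℝ
  eq_diagonal : S.transpose * ((whiten a n).transpose * whiten a n) * S = Matrix.diagonal μ

namespace IsPrecisionSpectrum

variable {a : ℝ} {S : Matrix (Fin n) (Fin n) ℝ} {μ : Fin n → ℝ}

/-- The eigenvalue is `‖B v‖²` for the unit vector `v` given by the `i`-th column of `S`. The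
uniform interval is what makes polynomial approximation applicable. -/
lemma mem_Icc (h : IsPrecisionSpectrum a S μ) (ha0 : 0 ≤ a) (ha1 : a < 1) (i : Fin n) :
    μ i ∈ Set.Icc 0 4 := by
  have h1 : μ i = ∑ j, (∑ k, whiten a n j k * S k i) ^ 2 := by
    have h2 := congrFun (congrFun h.eq_diagonal i) i
    rw [Matrix.diagonal_apply_eq] at h2
    have h3 : S.transpose * ((whiten a n).transpose * whiten a n) * S
        = (whiten a n * S).transpose * (whiten a n * S) := by
      rw [Matrix.transpose_mul]; simp only [Matrix.mul_assoc]
    rw [← h2, h3, Matrix.mul_apply]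
    refine Finset.sum_congr rfl fun j _ => ?_
    rw [Matrix.transpose_apply, Matrix.mul_apply, sq]
  refine ⟨h1 ▸ Finset.sum_nonneg fun j _ => sq_nonneg _, ?_⟩
  have h4 : ∑ k, S k i ^ 2 = 1 := by
    have := congrFun (congrFun ((Matrix.mem_orthogonalGroup_iff' _ _).1 h.orthogonal) i) i
    rw [Matrix.mul_apply, Matrix.one_apply_eq] at this
    simpa [sq] using this
  rw [h1]
  refine (sum_whiten_mulVec_sq_le ha0 ha1 fun k => S k i).trans ?_
  rw [h4, mul_one]

lemma pow_eq (h : IsPrecisionSpectrum a S μ) (k : ℕ) :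
    ((whiten a n).transpose * whiten a n) ^ k
      = S * Matrix.diagonal (fun i => μ i ^ k) * S.transpose := by
  have h1 := (Matrix.mem_orthogonalGroup_iff _ _).1 h.orthogonal
  have h2 := (Matrix.mem_orthogonalGroup_iff' _ _).1 h.orthogonal
  have h3 : (whiten a n).transpose * whiten a n = S * Matrix.diagonal μ * S.transpose := by
    rw [← h.eq_diagonal]
    calc _ = (S * S.transpose) * ((whiten a n).transpose * whiten a n) * (S * S.transpose) := by
          rw [h1, one_mul, mul_one]
      _ = _ := by simp only [Matrix.mul_assoc]
  induction k with
  | zero => simp [h1]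
  | succ k ih =>
    rw [pow_succ, ih, h3]
    calc _ = S * Matrix.diagonal (fun i => μ i ^ k) * (S.transpose * S) * Matrix.diagonal μ
          * S.transpose := by simp only [Matrix.mul_assoc]
      _ = _ := by
        rw [h2, mul_one, Matrix.mul_assoc S, Matrix.diagonal_mul_diagonal]
        simp only [pow_succ]

lemma trace_pow (h : IsPrecisionSpectrum a S μ) (k : ℕ) :
    (((whiten a n).transpose * whiten a n) ^ k).trace = ∑ i, μ i ^ k := by
  have h2 := (Matrix.mem_orthogonalGroup_iff' _ _).1 h.orthogonal
  rw [h.pow_eq, Matrix.trace_mul_cycle, h2, one_mul, Matrix.trace_diagonal]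

/-- A diagonal entry is the average of `μⱼ ^ k` with the weights `S i j ^ 2`, which sum to one. -/
lemma abs_pow_apply_le (h : IsPrecisionSpectrum a S μ) (ha0 : 0 ≤ a) (ha1 : a < 1) (k : ℕ)
    (i : Fin n) : |(((whiten a n).transpose * whiten a n) ^ k) i i| ≤ 4 ^ k := by
  have h4 : ∑ j, S i j ^ 2 = 1 := by
    have := congrFun (congrFun ((Matrix.mem_orthogonalGroup_iff _ _).1 h.orthogonal) i) i
    rw [Matrix.mul_apply, Matrix.one_apply_eq] at this
    simpa [sq] using this
  have h5 : (((whiten a n).transpose * whiten a n) ^ k) i i = ∑ j, S i j ^ 2 * μ j ^ k := by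
    rw [h.pow_eq, Matrix.mul_apply]
    refine Finset.sum_congr rfl fun j _ => ?_
    rw [Matrix.mul_diagonal, Matrix.transpose_apply]
    ring
  have hμ := h.mem_Icc ha0 ha1
  rw [h5, abs_of_nonneg (Finset.sum_nonneg fun j _ =>
    mul_nonneg (sq_nonneg _) (pow_nonneg (hμ j).1 k))]
  calc ∑ j, S i j ^ 2 * μ j ^ k ≤ ∑ j, S i j ^ 2 * 4 ^ k := Finset.sum_le_sum fun j _ =>
        mul_le_mul_of_nonneg_left (pow_le_pow_left₀ (hμ j).1 (hμ j).2 k) (sq_nonneg _)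
    _ = 4 ^ k := by rw [← Finset.sum_mul, h4, one_mul]

/-- Only the first `k` and last `k` diagonal entries can differ from the Toeplitz value, each by a
bounded amount; the bound does not grow with `n`. -/
lemma abs_sum_pow_sub_le (h : IsPrecisionSpectrum a S μ) (ha0 : 0 ≤ a) (ha1 : a < 1) (k : ℕ) :
    |∑ i, μ i ^ k - n * symbolCoeff a k 0| ≤ 2 * k * (4 ^ k + |symbolCoeff a k 0|) := by
  set C : ℝ := 4 ^ k + |symbolCoeff a k 0| with hC
  have hC0 : 0 ≤ C := by positivity
  have h1 : ∑ i, μ i ^ k - n * symbolCoeff a k 0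
      = ∑ i, ((((whiten a n).transpose * whiten a n) ^ k) i i - symbolCoeff a k 0) := by
    rw [← h.trace_pow, Matrix.trace, Finset.sum_sub_distrib]
    simp
  have h2 : ∀ i : Fin n, |(((whiten a n).transpose * whiten a n) ^ k) i i - symbolCoeff a k 0|
      ≤ if (i : ℕ) < k ∨ n ≤ (i : ℕ) + k then C else 0 := fun i => by
    split_ifs with hi
    · exact (abs_sub _ _).trans (add_le_add_left (h.abs_pow_apply_le ha0 ha1 k i) _)
    · push Not at hi
      rw [precision_pow_apply a k i i hi.1 hi.2]
      simp
  rw [h1]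
  calc _ ≤ ∑ i : Fin n, |(((whiten a n).transpose * whiten a n) ^ k) i i - symbolCoeff a k 0| :=
        Finset.abs_sum_le_sum_abs _ _
    _ ≤ ∑ i : Fin n, if (i : ℕ) < k ∨ n ≤ (i : ℕ) + k then C else 0 :=
        Finset.sum_le_sum fun i _ => h2 i
    _ = ∑ i ∈ Finset.range n, if i < k ∨ n ≤ i + k then C else 0 :=
        Fin.sum_univ_eq_sum_range (fun i => if i < k ∨ n ≤ i + k then C else 0) n
    _ = ((Finset.range n).filter fun i => i < k ∨ n ≤ i + k).card * C := by
        rw [← Finset.sum_filter, Finset.sum_const, nsmul_eq_mul]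
    _ ≤ 2 * k * C := by
        refine mul_le_mul_of_nonneg_right ?_ hC0
        have : ((Finset.range n).filter fun i => i < k ∨ n ≤ i + k)
            ⊆ Finset.range k ∪ Finset.Ico (n - k) n := fun i => by
          simp only [Finset.mem_filter, Finset.mem_range, Finset.mem_union, Finset.mem_Ico]
          omega
        have hcard := (Finset.card_le_card this).trans (Finset.card_union_le _ _)
        rw [Finset.card_range, Nat.card_Ico] at hcard
        have : ((Finset.range n).filter fun i => i < k ∨ n ≤ i + k).card ≤ 2 * k := by omega
        exact_mod_cast this

end IsPrecisionSpectrum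

variable {a : ℝ} {S : ∀ n, Matrix (Fin n) (Fin n) ℝ} {μ : ∀ n, Fin n → ℝ}

lemma tendsto_average_pow (ha0 : 0 ≤ a) (ha1 : a < 1)
    (h : ∀ n, IsPrecisionSpectrum a (S n) (μ n)) (k : ℕ) :
    Tendsto (fun n : ℕ => 1 / (n : ℝ) * ∑ i, μ n i ^ k) atTop
      (nhds (1 / (2 * Real.pi) * ∫ w in (-Real.pi)..Real.pi, precisionSymbol a w ^ k)) := by
  have h0 : 1 / (2 * Real.pi) * ∫ w in (-Real.pi)..Real.pi, precisionSymbol a w ^ k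
      = symbolCoeff a k 0 := by simp [symbolCoeff]
  rw [h0, tendsto_iff_norm_sub_tendsto_zero]
  set C : ℝ := 2 * k * (4 ^ k + |symbolCoeff a k 0|) with hC
  refine squeeze_zero' (Eventually.of_forall fun n => norm_nonneg _) ?_
    (tendsto_const_div_atTop_nhds_zero_nat C)
  filter_upwards [eventually_gt_atTop 0] with n hn
  have hn' : (0 : ℝ) < n := Nat.cast_pos.2 hn
  have h1 : 1 / (n : ℝ) * ∑ i, μ n i ^ k - symbolCoeff a k 0
      = (∑ i, μ n i ^ k - n * symbolCoeff a k 0) / n := by field_simp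
  rw [h1, Real.norm_eq_abs, abs_div, abs_of_pos hn']
  gcongr
  exact (h n).abs_sum_pow_sub_le ha0 ha1 k

lemma tendsto_average_polynomial (ha0 : 0 ≤ a) (ha1 : a < 1)
    (h : ∀ n, IsPrecisionSpectrum a (S n) (μ n)) (p : Polynomial ℝ) :
    Tendsto (fun n : ℕ => 1 / (n : ℝ) * ∑ i, p.eval (μ n i)) atTop
      (nhds (1 / (2 * Real.pi) * ∫ w in (-Real.pi)..Real.pi, p.eval (precisionSymbol a w))) := by
  induction p using Polynomial.induction_on' with
  | add p q hp hq =>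
    have hi : ∀ p : Polynomial ℝ, IntervalIntegrable (fun w => p.eval (precisionSymbol a w))
        volume (-Real.pi) Real.pi := fun p =>
      (p.continuous.comp (continuous_precisionSymbol a)).intervalIntegrable _ _
    simp only [Polynomial.eval_add, Finset.sum_add_distrib, mul_add]
    rw [intervalIntegral.integral_add (hi p) (hi q), mul_add]
    exact hp.add hq
  | monomial k c =>
    simp only [Polynomial.eval_monomial, ← Finset.mul_sum, intervalIntegral.integral_const_mul,
      mul_left_comm _ c]
    exact (tendsto_average_pow ha0 ha1 h k).const_mul c

/-- The limiting eigenvalue distribution of the precision matrices. -/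
lemma tendsto_average (ha0 : 0 ≤ a) (ha1 : a < 1)
    (h : ∀ n, IsPrecisionSpectrum a (S n) (μ n)) {F : ℝ → ℝ} (hF : Continuous F) :
    Tendsto (fun n : ℕ => 1 / (n : ℝ) * ∑ i, F (μ n i)) atTop
      (nhds (1 / (2 * Real.pi) * ∫ w in (-Real.pi)..Real.pi, F (precisionSymbol a w))) := by
  rw [Metric.tendsto_atTop]
  intro ε hε
  obtain ⟨p, hp⟩ := exists_polynomial_near_of_continuousOn 0 4 F hF.continuousOn (ε / 3)
    (by positivity)
  obtain ⟨N, hN⟩ := Metric.tendsto_atTop.1 (tendsto_average_polynomial ha0 ha1 h p) (ε / 3)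
    (by positivity)
  have hpi := Real.pi_pos
  have hsym : ∀ w, precisionSymbol a w ∈ Set.Icc 0 4 := fun w =>
    ⟨(sq_nonneg _).trans (precisionSymbol_bounds ha0 ha1 w).1, (precisionSymbol_bounds ha0 ha1 w).2⟩
  have h1 : |1 / (2 * Real.pi) * (∫ w in (-Real.pi)..Real.pi, p.eval (precisionSymbol a w))
      - 1 / (2 * Real.pi) * ∫ w in (-Real.pi)..Real.pi, F (precisionSymbol a w)| ≤ ε / 3 := by
    have hi1 : IntervalIntegrable (fun w => p.eval (precisionSymbol a w)) volume (-Real.pi)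
        Real.pi := (p.continuous.comp (continuous_precisionSymbol a)).intervalIntegrable _ _
    have hi2 : IntervalIntegrable (fun w => F (precisionSymbol a w)) volume (-Real.pi)
        Real.pi := (hF.comp (continuous_precisionSymbol a)).intervalIntegrable _ _
    rw [← mul_sub, ← intervalIntegral.integral_sub hi1 hi2, abs_mul,
      abs_of_pos (by positivity : 0 < 1 / (2 * Real.pi))]
    have := intervalIntegral.norm_integral_le_of_norm_le_const (a := -Real.pi) (b := Real.pi)
      (C := ε / 3) (f := fun w => p.eval (precisionSymbol a w) - F (precisionSymbol a w))
      fun w _ => (hp _ (hsym w)).le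
    rw [Real.norm_eq_abs, abs_of_pos (by linarith : 0 < Real.pi - -Real.pi)] at this
    calc _ ≤ 1 / (2 * Real.pi) * (ε / 3 * (Real.pi - -Real.pi)) := by gcongr
      _ = ε / 3 := by field_simp; ring
  refine ⟨N, fun n hn => ?_⟩
  have h2 : |1 / (n : ℝ) * ∑ i, F (μ n i) - 1 / (n : ℝ) * ∑ i, p.eval (μ n i)| ≤ ε / 3 := by
    rw [← mul_sub, ← Finset.sum_sub_distrib, abs_mul, abs_of_nonneg (by positivity)]
    have h3 : |∑ i, (F (μ n i) - p.eval (μ n i))| ≤ n * (ε / 3) := by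
      refine (Finset.abs_sum_le_sum_abs _ _).trans ?_
      refine (Finset.sum_le_sum fun i _ => ?_).trans_eq
        (by rw [Finset.sum_const, Finset.card_univ, Fintype.card_fin, nsmul_eq_mul])
      rw [abs_sub_comm]
      exact (hp _ ((h n).mem_Icc ha0 ha1 i)).le
    rcases Nat.eq_zero_or_pos n with h0 | h0
    · subst h0; simp; positivity
    · have hn' : (0 : ℝ) < n := Nat.cast_pos.2 h0
      calc _ ≤ 1 / (n : ℝ) * (n * (ε / 3)) := by gcongr
        _ = ε / 3 := by field_simp
  have h3 := hN n hn
  rw [Real.dist_eq] at h3 ⊢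
  have h4 := abs_lt.1 h3
  have h5 := abs_le.1 h1
  have h6 := abs_le.1 h2
  rw [abs_lt]
  constructor <;> linarith [h4.1, h4.2, h5.1, h5.2, h6.1, h6.2]

end Szego

/-! ### Limiting waterfilling and the limit of the normalized variance. -/

section LimitingWaterfill

variable {a : ℝ} {σ : ℝ≥0}

lemma powerSpectrum_eq (a : ℝ) (σ : ℝ≥0) (w : ℝ) :
    powerSpectrum a σ w = (σ : ℝ) ^ 2 / precisionSymbol a w := rfl

lemma precisionSymbol_pos (ha0 : 0 ≤ a) (ha1 : a < 1) (w : ℝ) : 0 < precisionSymbol a w :=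
  (pow_pos (sub_pos.2 ha1) 2).trans_le (precisionSymbol_bounds ha0 ha1 w).1

lemma continuous_powerSpectrum (ha0 : 0 ≤ a) (ha1 : a < 1) : Continuous (powerSpectrum a σ) :=
  continuous_const.div (continuous_precisionSymbol a) fun w => (precisionSymbol_pos ha0 ha1 w).ne'

lemma powerSpectrum_nonneg (ha0 : 0 ≤ a) (ha1 : a < 1) (w : ℝ) : 0 ≤ powerSpectrum a σ w :=
  div_nonneg (sq_nonneg _) (precisionSymbol_pos ha0 ha1 w).le

lemma powerSpectrum_le (ha0 : 0 ≤ a) (ha1 : a < 1) (w : ℝ) :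
    powerSpectrum a σ w ≤ (σ : ℝ) ^ 2 / (1 - a) ^ 2 :=
  div_le_div_of_nonneg_left (sq_nonneg _) (pow_pos (sub_pos.2 ha1) 2)
    (precisionSymbol_bounds ha0 ha1 w).1

/-- The distortion `(1/2π) ∫ min(t, S(w)) dw` of limiting reverse waterfilling at level `t`. -/
noncomputable def limitWaterfill (a : ℝ) (σ : ℝ≥0) (t : ℝ) : ℝ :=
  1 / (2 * Real.pi) * ∫ w in (-Real.pi)..Real.pi, min t (powerSpectrum a σ w)

lemma intervalIntegrable_min_powerSpectrum (ha0 : 0 ≤ a) (ha1 : a < 1) (t : ℝ) :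
    IntervalIntegrable (fun w => min t (powerSpectrum a σ w)) volume (-Real.pi) Real.pi :=
  (continuous_const.min (continuous_powerSpectrum ha0 ha1)).intervalIntegrable _ _

lemma concaveOn_limitWaterfill (ha0 : 0 ≤ a) (ha1 : a < 1) :
    ConcaveOn ℝ Set.univ (limitWaterfill a σ) := by
  have hpi := Real.pi_pos
  have h := fun t => intervalIntegrable_min_powerSpectrum (σ := σ) ha0 ha1 t
  have h1 : ConcaveOn ℝ Set.univ fun t : ℝ =>
      ∫ w in (-Real.pi)..Real.pi, min t (powerSpectrum a σ w) := by
    refine ⟨convex_univ, fun t _ t' _ α β hα hβ hαβ => ?_⟩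
    simp only [smul_eq_mul]
    rw [← intervalIntegral.integral_const_mul, ← intervalIntegral.integral_const_mul,
      ← intervalIntegral.integral_add ((h t).const_mul α) ((h t').const_mul β)]
    refine intervalIntegral.integral_mono_on (by linarith)
      (((h t).const_mul α).add ((h t').const_mul β)) (h _) fun w _ => ?_
    exact (concaveOn_min_const (powerSpectrum a σ w)).2 (Set.mem_univ t) (Set.mem_univ t') hα hβ
      hαβ
  exact h1.smul (by positivity : (0 : ℝ) ≤ 1 / (2 * Real.pi))

lemma monotone_limitWaterfill (ha0 : 0 ≤ a) (ha1 : a < 1) :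
    Monotone (limitWaterfill a σ) := fun t t' htt' => by
  have hpi := Real.pi_pos
  refine mul_le_mul_of_nonneg_left ?_ (by positivity)
  exact intervalIntegral.integral_mono_on (by linarith)
    (intervalIntegrable_min_powerSpectrum ha0 ha1 t)
    (intervalIntegrable_min_powerSpectrum ha0 ha1 t') fun w _ => min_le_min_right _ htt'

lemma continuous_limitWaterfill (ha0 : 0 ≤ a) (ha1 : a < 1) : Continuous (limitWaterfill a σ) :=
  continuousOn_univ.1 ((concaveOn_limitWaterfill ha0 ha1).continuousOn isOpen_univ)

/-- Besides the value at `0`, this serves `tendsto_level`, which asks for convergence of the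
waterfilling curves at every real level. -/
lemma limitWaterfill_of_nonpos (ha0 : 0 ≤ a) (ha1 : a < 1) {t : ℝ} (ht : t ≤ 0) :
    limitWaterfill a σ t = t := by
  have hpi := Real.pi_pos
  unfold limitWaterfill
  simp_rw [fun w => min_eq_left (ht.trans (powerSpectrum_nonneg (σ := σ) ha0 ha1 w))]
  rw [intervalIntegral.integral_const, smul_eq_mul]
  field_simp
  ring

lemma limitWaterfill_eq_maxDistortion (ha0 : 0 ≤ a) (ha1 : a < 1) :
    limitWaterfill a σ ((σ : ℝ) ^ 2 / (1 - a) ^ 2) = maxDistortion a σ := by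
  unfold limitWaterfill maxDistortion
  simp_rw [fun w => min_eq_right (powerSpectrum_le (σ := σ) ha0 ha1 w)]

lemma existsUnique_isLimitingWaterLevel (ha0 : 0 ≤ a) (ha1 : a < 1) {d : ℝ} (hd0 : 0 < d)
    (hd1 : d < maxDistortion a σ) : ∃! θ, IsLimitingWaterLevel a σ d θ :=
  existsUnique_level (concaveOn_limitWaterfill ha0 ha1) (monotone_limitWaterfill ha0 ha1)
    (continuous_limitWaterfill ha0 ha1) (limitWaterfill_of_nonpos ha0 ha1 le_rfl) hd0
    (hd1.trans_eq (limitWaterfill_eq_maxDistortion ha0 ha1).symm)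

/-- Clipping a variance `c / x` at `t` keeps the eigenvalue `x` away from `0`. The right side is
continuous in `x` on the whole line, so no lower bound on the eigenvalues is required. -/
lemma min_div_eq_div_max {t x c : ℝ} (ht : 0 < t) (hx : 0 < x) (hc : 0 < c) :
    min t (c / x) = c / max (c / t) x := by
  rcases le_total (c / t) x with h | h
  · rw [max_eq_right h, min_eq_right]
    rw [div_le_iff₀ hx]
    rwa [div_le_iff₀ ht, mul_comm] at h
  · rw [max_eq_left h, min_eq_left, div_div_cancel₀ hc.ne']
    rw [le_div_iff₀ hx]
    rwa [le_div_iff₀ ht, mul_comm] at h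

variable {S : ∀ n, Matrix (Fin n) (Fin n) ℝ} {s : ∀ n, Fin n → ℝ}

/-- Limits of averages of functions of the clipped eigenvalues. -/
lemma tendsto_average_min (ha0 : 0 ≤ a) (ha1 : a < 1) (hσ : 0 < σ) (hs : ∀ n i, 0 < s n i)
    (h : ∀ n, IsPrecisionSpectrum a (S n) fun i => (σ : ℝ) ^ 2 / s n i) {t : ℝ} (ht : 0 < t)
    {g : ℝ → ℝ} (hg : Continuous g) :
    Tendsto (fun n : ℕ => 1 / (n : ℝ) * ∑ i, g (min t (s n i))) atTop
      (nhds (1 / (2 * Real.pi) *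
        ∫ w in (-Real.pi)..Real.pi, g (min t (powerSpectrum a σ w)))) := by
  have hσ' : (0 : ℝ) < (σ : ℝ) ^ 2 := pow_pos (NNReal.coe_pos.2 hσ) 2
  have hF : Continuous fun x : ℝ => g ((σ : ℝ) ^ 2 / max ((σ : ℝ) ^ 2 / t) x) :=
    hg.comp (continuous_const.div (by fun_prop) fun x =>
      ((div_pos hσ' ht).trans_le (le_max_left _ _)).ne')
  have h1 := tendsto_average ha0 ha1 h hF
  have h2 : ∀ n i, (σ : ℝ) ^ 2 / max ((σ : ℝ) ^ 2 / t) ((σ : ℝ) ^ 2 / s n i)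
      = min t (s n i) := fun n i => by
    rw [← min_div_eq_div_max ht (div_pos hσ' (hs n i)) hσ', div_div_cancel₀ hσ'.ne']
  have h3 : ∀ w, (σ : ℝ) ^ 2 / max ((σ : ℝ) ^ 2 / t) (precisionSymbol a w)
      = min t (powerSpectrum a σ w) := fun w => by
    rw [powerSpectrum_eq, min_div_eq_div_max ht (precisionSymbol_pos ha0 ha1 w) hσ']
  simpa only [h2, h3] using h1

lemma tendsto_waterfill (ha0 : 0 ≤ a) (ha1 : a < 1) (hσ : 0 < σ) (hs : ∀ n i, 0 < s n i)
    (h : ∀ n, IsPrecisionSpectrum a (S n) fun i => (σ : ℝ) ^ 2 / s n i) (t : ℝ) :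
    Tendsto (fun n => waterfill (s n) t) atTop (nhds (limitWaterfill a σ t)) := by
  rcases le_or_gt t 0 with ht | ht
  · rw [limitWaterfill_of_nonpos ha0 ha1 ht]
    refine tendsto_const_nhds.congr' ?_
    filter_upwards [eventually_gt_atTop 0] with n hn
    have hn' : (n : ℝ) ≠ 0 := Nat.cast_ne_zero.2 hn.ne'
    unfold waterfill
    simp_rw [fun i => min_eq_left (ht.trans (hs n i).le)]
    simp
    field_simp
  · exact tendsto_average_min ha0 ha1 hσ hs h ht continuous_id

/-- The average variance dominates the waterfilling curve at the level `σ²/(1 - a)²`, which bounds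
the spectrum; there the curve tends to `maxDistortion a σ > d`. -/
lemma eventually_lt_average (ha0 : 0 ≤ a) (ha1 : a < 1) (hσ : 0 < σ) (hs : ∀ n i, 0 < s n i)
    (h : ∀ n, IsPrecisionSpectrum a (S n) fun i => (σ : ℝ) ^ 2 / s n i) {d : ℝ}
    (hd1 : d < maxDistortion a σ) : ∀ᶠ n : ℕ in atTop, d < 1 / (n : ℝ) * ∑ i, s n i := by
  rw [← limitWaterfill_eq_maxDistortion ha0 ha1] at hd1
  filter_upwards [(tendsto_waterfill ha0 ha1 hσ hs h _).eventually_const_lt hd1] with n hn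
  exact hn.trans_le (waterfill_le _)

/-- The limit of the normalized variance of the tilted information. -/
lemma tendsto_dispersion (ha0 : 0 ≤ a) (ha1 : a < 1) (hσ : 0 < σ) (hs : ∀ n i, 0 < s n i)
    (h : ∀ n, IsPrecisionSpectrum a (S n) fun i => (σ : ℝ) ^ 2 / s n i) {d θ : ℝ}
    (hd1 : d < maxDistortion a σ) (hθ : IsLimitingWaterLevel a σ d θ) {τ : ℕ → ℝ}
    (hτ : ∀ᶠ n in atTop, IsWaterLevel (s n) d (τ n)) :
    Tendsto (fun n : ℕ => 1 / (n : ℝ) * (1 / 2 * ∑ i, (min (τ n) (s n i) / τ n) ^ 2)) atTop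
      (nhds (1 / (4 * Real.pi) *
        ∫ w in (-Real.pi)..Real.pi, min 1 ((powerSpectrum a σ w / θ) ^ 2))) := by
  have hpi := Real.pi_pos
  obtain ⟨hθ0, hθd⟩ := hθ
  have hτθ : Tendsto τ atTop (nhds θ) := tendsto_level (F := fun n => waterfill (s n))
    (concaveOn_limitWaterfill ha0 ha1) (monotone_limitWaterfill ha0 ha1)
    (fun n => monotone_waterfill) (tendsto_waterfill ha0 ha1 hσ hs h) tendsto_const_nhds
    (hτ.mono fun n hn => hn.2.symm) hθd.symm
    (hd1.trans_eq (limitWaterfill_eq_maxDistortion ha0 ha1).symm)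
  have h1 := tendsto_average_min ha0 ha1 hσ hs h hθ0 (continuous_pow 2)
  -- The moving level is replaced by its limit: the squared clipped variances change by at most `|τ
  -- n - θ| (τ n + θ)`, uniformly over the variances.
  have hdiff : Tendsto (fun n : ℕ => 1 / (n : ℝ) * ∑ i, min (τ n) (s n i) ^ 2
      - 1 / (n : ℝ) * ∑ i, min θ (s n i) ^ 2) atTop (nhds 0) := by
    have hb : Tendsto (fun n => |τ n - θ| * (τ n + θ)) atTop (nhds 0) := by
      have := ((hτθ.sub_const θ).abs).mul (hτθ.add_const θ)
      simpa using this
    refine squeeze_zero_norm' ?_ hb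
    filter_upwards [hτ, eventually_gt_atTop 0] with n hn hn0
    have hn' : (0 : ℝ) < n := Nat.cast_pos.2 hn0
    rw [← mul_sub, ← Finset.sum_sub_distrib, Real.norm_eq_abs, abs_mul,
      abs_of_pos (by positivity : 0 < 1 / (n : ℝ))]
    have hi : ∀ i, |min (τ n) (s n i) ^ 2 - min θ (s n i) ^ 2| ≤ |τ n - θ| * (τ n + θ) :=
      fun i => by
        have h2 : |min (τ n) (s n i) - min θ (s n i)| ≤ |τ n - θ| := by
          simpa using abs_min_sub_min_le_max (τ n) (s n i) θ (s n i)
        have h3 : 0 ≤ min (τ n) (s n i) + min θ (s n i) :=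
          add_nonneg (le_min hn.1.le (hs n i).le) (le_min hθ0.le (hs n i).le)
        have h4 : min (τ n) (s n i) + min θ (s n i) ≤ τ n + θ :=
          add_le_add (min_le_left _ _) (min_le_left _ _)
        rw [sq_sub_sq, abs_mul, abs_of_nonneg h3, mul_comm]
        exact mul_le_mul h2 h4 h3 (abs_nonneg _)
    calc _ ≤ 1 / (n : ℝ) * ∑ i : Fin n, |τ n - θ| * (τ n + θ) := by
          gcongr
          exact (Finset.abs_sum_le_sum_abs _ _).trans (Finset.sum_le_sum fun i _ => hi i)
      _ = _ := by
          rw [Finset.sum_const, Finset.card_univ, Fintype.card_fin, nsmul_eq_mul]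
          field_simp
  have h2 := hdiff.add h1
  simp only [sub_add_cancel, zero_add] at h2
  have h3 := (h2.div (hτθ.pow 2) (pow_pos hθ0 2).ne').const_mul (1 / 2)
  have hlim : 1 / 2 * ((1 / (2 * Real.pi) *
      ∫ w in (-Real.pi)..Real.pi, min θ (powerSpectrum a σ w) ^ 2) / θ ^ 2)
      = 1 / (4 * Real.pi) *
        ∫ w in (-Real.pi)..Real.pi, min 1 ((powerSpectrum a σ w / θ) ^ 2) := by
    have hpt : ∀ w, min 1 ((powerSpectrum a σ w / θ) ^ 2)
        = min θ (powerSpectrum a σ w) ^ 2 * (1 / θ ^ 2) := fun w => by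
      have h0 : 0 ≤ powerSpectrum a σ w / θ :=
        div_nonneg (powerSpectrum_nonneg ha0 ha1 w) hθ0.le
      rcases le_total θ (powerSpectrum a σ w) with hle | hle
      · have : 1 ≤ powerSpectrum a σ w / θ := (one_le_div hθ0).2 hle
        rw [min_eq_left hle, min_eq_left (one_le_pow₀ this)]
        field_simp
      · have : powerSpectrum a σ w / θ ≤ 1 := (div_le_one hθ0).2 hle
        rw [min_eq_right hle, min_eq_right (pow_le_one₀ h0 this), div_pow]
        ring
    simp_rw [hpt]
    rw [intervalIntegral.integral_mul_const]
    field_simp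
    ring
  rw [hlim] at h3
  refine h3.congr fun n => ?_
  simp only [Pi.div_apply, div_pow, ← Finset.sum_div]
  ring

end LimitingWaterfill

lemma evariance_comp_eq {Ω β : Type*} [MeasurableSpace Ω] [MeasurableSpace β] {P : Measure Ω}
    {V : Ω → β} (hV : Measurable V) {f : β → ℝ} (hf : Measurable f) :
    evariance (fun ω => f (V ω)) P = evariance f (P.map V) := by
  rw [evariance, evariance, lintegral_map (by fun_prop) hV,
    integral_map hV.aemeasurable hf.aestronglyMeasurable]

/-! ### Diagonalization of the covariance, and the theorem. -/

namespace IsGaussMarkov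

variable {Ω : Type*} [MeasurableSpace Ω] {P : Measure Ω} {a : ℝ} {σ : ℝ≥0} {U : ℕ → Ω → ℝ}

lemma trace_covMatrix {n : ℕ} {S : Matrix (Fin n) (Fin n) ℝ} {s : Fin n → ℝ}
    (hS : S ∈ Matrix.orthogonalGroup (Fin n) ℝ)
    (hcov : covMatrix P U n = S * Matrix.diagonal s * S.transpose) :
    (covMatrix P U n).trace / n = 1 / (n : ℝ) * ∑ i, s i := by
  rw [hcov, Matrix.trace_mul_cycle, (Matrix.mem_orthogonalGroup_iff' _ _).1 hS, one_mul,
    Matrix.trace_diagonal]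
  ring

/-- Existence of minimizers and the dispersion involve no given decorrelating matrix; the spectral
theorem supplies one for each `n`. -/
lemma exists_diagonalization (n : ℕ) :
    ∃ (S : Matrix (Fin n) (Fin n) ℝ) (s : Fin n → ℝ), S ∈ Matrix.orthogonalGroup (Fin n) ℝ ∧
      covMatrix P U n = S * Matrix.diagonal s * S.transpose := by
  have h : (covMatrix P U n).IsHermitian := by
    ext i j
    simp [covMatrix, mul_comm]
  refine ⟨h.eigenvectorUnitary, h.eigenvalues, h.eigenvectorUnitary.2, ?_⟩
  have := h.spectral_theorem
  simpa [Unitary.conjStarAlgAut_apply, Matrix.star_eq_conjTranspose] using this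

lemma pos_and_isPrecisionSpectrum (hU : IsGaussMarkov P a σ U) (hσ : 0 < σ) {n : ℕ}
    {S : Matrix (Fin n) (Fin n) ℝ} {s : Fin n → ℝ}
    (hS : S ∈ Matrix.orthogonalGroup (Fin n) ℝ)
    (hcov : covMatrix P U n = S * Matrix.diagonal s * S.transpose) :
    (∀ i, 0 < s i) ∧ IsPrecisionSpectrum a S fun i => (σ : ℝ) ^ 2 / s i := by
  have h := hU.whiten_covMatrix n
  rw [hcov] at h
  obtain ⟨h1, h2⟩ := diagonalize_precision (pow_pos (NNReal.coe_pos.2 hσ) 2) h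
  exact ⟨h1, hS, h2⟩

lemma lintegral_distortion_sourceVec (hU : IsGaussMarkov P a σ U) (n : ℕ) :
    ∫⁻ u, ENNReal.ofReal (distortion u 0) ∂(P.map (sourceVec U n))
      = ENNReal.ofReal ((covMatrix P U n).trace / n) := by
  have h : ∀ ω, distortion (sourceVec U n ω) 0
      = 1 / (n : ℝ) * ∑ i : Fin n, U (i + 1) ω * U (i + 1) ω :=
    fun ω => by
      rw [distortion, sub_zero, EuclideanSpace.real_norm_sq_eq]
      simp [sourceVec, sq]
  have hI : ∀ i : Fin n, Integrable (fun ω => U (i + 1) ω * U (i + 1) ω) P := fun i =>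
    (hU.memLp i).integrable_mul (hU.memLp i)
  have hm : Measurable fun u : EuclideanSpace ℝ (Fin n) => ENNReal.ofReal (distortion u 0) := by
    unfold distortion; fun_prop
  rw [lintegral_map hm (hU.measurable_sourceVec n)]
  simp_rw [h]
  rw [← ofReal_integral_eq_lintegral_ofReal
    ((integrable_finsetSum _ fun i _ => hI i).const_mul _)
    (ae_of_all _ fun ω => mul_nonneg (by positivity)
      (Finset.sum_nonneg fun i _ => mul_self_nonneg _)), integral_const_mul,
    integral_finsetSum _ fun i _ => hI i]
  congr 1
  simp only [Matrix.trace, Matrix.diag, covMatrix, Matrix.of_apply]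
  ring

end IsGaussMarkov

theorem theorem2 {Ω : Type*} [MeasurableSpace Ω] (P : Measure Ω) [IsProbabilityMeasure P]
    (a : ℝ) (ha0 : 0 ≤ a) (ha1 : a < 1) (σ : ℝ≥0) (hσ : 0 < σ)
    (U : ℕ → Ω → ℝ) (hU : IsGaussMarkov P a σ U)
    (d : ℝ) (hd0 : 0 < d) (hd1 : d < maxDistortion a σ) :
    -- rate-distortion achieving conditional distributions exist at every blocklength
    (∀ n : ℕ, 1 ≤ n → ∃ κ, IsRDFAchieving (P.map (sourceVec U n)) d κ) ∧
    -- the distortion is nontrivial at all large blocklengths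
    (∀ᶠ n : ℕ in atTop, d < (covMatrix P U n).trace / n) ∧
    -- the tilted information, at every blocklength where the distortion is nontrivial
    (∀ n : ℕ, 1 ≤ n → d < (covMatrix P U n).trace / n →
      ∀ (S : Matrix (Fin n) (Fin n) ℝ) (s : Fin n → ℝ),
        S ∈ Matrix.orthogonalGroup (Fin n) ℝ →
        covMatrix P U n = S * Matrix.diagonal s * S.transpose →
        DifferentiableAt ℝ (rdf (P.map (sourceVec U n))) d ∧
        DifferentiableAt ℝ (rdf (P.map fun ω => decorrelate S (sourceVec U n ω))) d ∧
        (∃ κ, IsRDFAchieving (P.map fun ω => decorrelate S (sourceVec U n ω)) d κ) ∧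
        (∃! θ, IsWaterLevel s d θ) ∧
        ∀ θ, IsWaterLevel s d θ →
        ∀ κU, IsRDFAchieving (P.map (sourceVec U n)) d κU →
        ∀ κX, IsRDFAchieving (P.map fun ω => decorrelate S (sourceVec U n ω)) d κX →
        ∀ u x : EuclideanSpace ℝ (Fin n), x = decorrelate S u →
          tiltedInfo (P.map (sourceVec U n)) d κU u
            = tiltedInfo (P.map fun ω => decorrelate S (sourceVec U n ω)) d κX x ∧
          tiltedInfo (P.map fun ω => decorrelate S (sourceVec U n ω)) d κX x
            = ∑ i, (min θ (s i) / (2 * θ) * (x i ^ 2 / s i - 1)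
                + 1 / 2 * Real.log (max θ (s i) / θ))) ∧
    -- the informational dispersion
    (∃! θ, IsLimitingWaterLevel a σ d θ) ∧
    ∀ θ, IsLimitingWaterLevel a σ d θ →
      ∀ κ : ∀ n : ℕ, Kernel (EuclideanSpace ℝ (Fin n)) (EuclideanSpace ℝ (Fin n)),
        (∀ n : ℕ, 1 ≤ n → IsRDFAchieving (P.map (sourceVec U n)) d (κ n)) →
        informationalDispersion P U d κ
          = ENNReal.ofReal ((1 / (4 * Real.pi)) *
              ∫ w in (-Real.pi)..Real.pi, min 1 ((powerSpectrum a σ w / θ) ^ 2)) := by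
  have hdiag := fun n => IsGaussMarkov.exists_diagonalization (P := P) (U := U) n
  choose S s hS hcov using hdiag
  have hs : ∀ n i, 0 < s n i := fun n => (hU.pos_and_isPrecisionSpectrum hσ (hS n) (hcov n)).1
  have hspec := fun n => (hU.pos_and_isPrecisionSpectrum hσ (hS n) (hcov n)).2
  have hev : ∀ᶠ n : ℕ in atTop, d < (covMatrix P U n).trace / n := by
    simp_rw [fun n => IsGaussMarkov.trace_covMatrix (hS n) (hcov n)]
    exact eventually_lt_average ha0 ha1 hσ hs hspec hd1
  refine ⟨fun n hn => ?_, hev, ?_, existsUnique_isLimitingWaterLevel ha0 ha1 hd0 hd1, ?_⟩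
  · rcases lt_or_ge d ((covMatrix P U n).trace / n) with h | h
    · rw [IsGaussMarkov.trace_covMatrix (hS n) (hcov n)] at h
      have hc := hcov n
      have hsn := hs n
      lift s n to Fin n → ℝ≥0 using fun i => (hs n i).le with r
      rw [hU.map_sourceVec (hS n) hc]
      exact exists_isRDFAchieving_gaussianVec _ hn (fun i => NNReal.coe_pos.1 (hsn i)) hd0 h
    -- When `d` is at least the mean energy, the zero output already meets the distortion
    -- constraint.
    · have := Measure.isProbabilityMeasure_map (μ := P) (hU.measurable_sourceVec n).aemeasurable
      refine exists_isRDFAchieving_of_le _ ?_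
      rw [hU.lintegral_distortion_sourceVec]
      exact ENNReal.ofReal_le_ofReal h
  · intro n hn hd S s hS hcov
    have hs := (hU.pos_and_isPrecisionSpectrum hσ hS hcov).1
    lift s to Fin n → ℝ≥0 using fun i => (hs i).le
    have hs' : ∀ i, 0 < s i := fun i => NNReal.coe_pos.1 (hs i)
    rw [IsGaussMarkov.trace_covMatrix hS hcov] at hd
    rw [hU.map_sourceVec hS hcov, hU.map_decorrelate hS hcov]
    have hex := existsUnique_isWaterLevel (fun i => (hs i).le) hd0 hd
    obtain ⟨θ₀, hθ₀, -⟩ := id hex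
    refine ⟨(hasDerivAt_rdf_gaussianVec _ hn hs' hd0 hd hθ₀).differentiableAt,
      (hasDerivAt_rdf_gaussianVec _ hn hs' hd0 hd hθ₀).differentiableAt,
      exists_isRDFAchieving_gaussianVec _ hn hs' hd0 hd, hex, ?_⟩
    intro θ hθ κU hκU κX hκX u x hx
    rw [tiltedInfo_gaussianVec _ hn hs' hd0 hd hθ hκU,
      tiltedInfo_gaussianVec _ hn hs' hd0 hd hθ hκX]
    -- Both laws have the same variances; their coordinate maps are `orthogonalEquiv S hS` and the
    -- identity, and the inverse of the former is `decorrelate S` by definition. Both tilted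
    -- informations are thus the same sum.
    subst hx
    exact ⟨rfl, rfl⟩
  · intro θ hθ κ hκ
    have hev' : ∀ᶠ n : ℕ in atTop, d < 1 / (n : ℝ) * ∑ i, s n i :=
      eventually_lt_average ha0 ha1 hσ hs hspec hd1
    have hex : ∀ n : ℕ, d < 1 / (n : ℝ) * ∑ i, s n i → ∃ τ, IsWaterLevel (s n) d τ := fun n hn =>
      (existsUnique_isWaterLevel (fun i => (hs n i).le) hd0 hn).exists
    choose! τ hτ using hex
    have hlim := tendsto_dispersion ha0 ha1 hσ hs hspec hd1 hθ (hev'.mono hτ)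
    -- The limsup is an actual limit, so it suffices to identify the normalized variance for all
    -- large `n`, where `d` is below the average variance.
    refine ((ENNReal.tendsto_ofReal hlim).congr' ?_).limsup_eq
    filter_upwards [hev', eventually_gt_atTop 0] with n hn hn0
    have hwl := hτ n hn
    have hc := hcov n
    have hsn := hs n
    have hκn := hκ n hn0
    have hn' : (0 : ℝ) < n := Nat.cast_pos.2 hn0
    lift s n to Fin n → ℝ≥0 using fun i => (hs n i).le with r
    have hs' : ∀ i, 0 < r i := fun i => NNReal.coe_pos.1 (hsn i)
    have hlaw := hU.map_sourceVec (hS n) hc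
    rw [hlaw] at hκn ⊢
    simp_rw [tiltedInfo_gaussianVec _ hn0 hs' hd0 hn hwl hκn]
    rw [evariance_comp_eq (hU.measurable_sourceVec n) (continuous_waterfillTilt _ _).measurable,
      hlaw, evariance_waterfillTilt _ hs' hwl.1, ← ENNReal.ofReal_natCast n,
      ← ENNReal.ofReal_div_of_pos hn']
    congr 1
    ring
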